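/- **Setting.** Let $1\le k\le n$ and $\epsilon,\delta\in(0,1)$. An $n$-qubit process is a completely positive trace-preserving linear map $\mathcal E$ on $n$-qubit operators. Its normalized Choi matrix is the $2n$-qubit state $\rho=2^{-n}\sum_{x,y\in\{0,1\}^n}|x\rangle\langle y|\otimes\mathcal E(|x\rangle\langle y|)$. For a set $S$ of $k$ of the $n$ qubits, the reduced $k$-qubit process Choi matrix $\rho_S$ is the partial trace of $\rho$ over all input and output qubits outside $S$ (equivalently, the normalized Choi matrix of $\sigma\mapsto\mathrm{tr}_{S^c}\,\mathcal E(\sigma\otimes I/2^{n-k})$). A measurement primitive on the $2n$ qubits is a measure $w$ on a space of outcomes $\omega$ with unit vectors $\psi_\omega$, depending measurably on $\omega$, such that $\int|\psi_\omega\rangle\langle\psi_\omega|\,dw(\omega)=I$. Measuring $\rho$ gives an outcome with law $\langle\psi_\omega|\rho|\psi_\omega\rangle\,dw(\omega)$. (For a random unitary $U$ followed by a computational-basis measurement, the outcomes are pairs $(U,b)$ and $\psi_{U,b}=U^\dagger|b\rangle$.) It is tomographically complete if $\mathcal M(X)=\int\langle\psi_\omega|X|\psi_\omega\rangle\,|\psi_\omega\rangle\langle\psi_\omega|\,dw(\omega)$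 is invertible. Its shadow norm is $$\|O\|_{\rm shadow}=\max_\sigma\Big(\int\langle\psi_\omega|\sigma|\psi_\omega\rangle\,\langle\psi_\omega|\mathcal M^{-1}(O)|\psi_\omega\rangle^2\,dw(\omega)\Big)^{1/2},$$ the maximum being over all density matrices $\sigma$. From independent measurements $\omega_1,\dots,\omega_N$ of $\rho$ form the classical shadows $\mathcal M^{-1}(|\psi_{\omega_i}\rangle\langle\psi_{\omega_i}|)$. For each of the $16^k$ Pauli strings $O$ on the $2k$ input and output qubits of $S$, let $\hat\alpha_O$ be the median-of-means estimate of $\mathrm{tr}(\rho\,(O\otimes I))$ computed from these shadows, and put $\hat\rho_S=4^{-k}\sum_O\hat\alpha_O\,O$. "$N$ measurements suffice for error $\epsilon$ in a norm" means: for a suitable number of batches in the median of means (one batch, i.e. the plain mean, is allowed), which does not depend on the process, it holds for every $n$-qubit process that, with probability at least $1-\delta$, $\|\hat\rho_S-\rho_S\|\le\epsilon$ simultaneously for all $k$-element sets $S$ of qubits. **Theorem.** (i) For every tomographically complete measurement primitive, $N$ measurements suffice for Frobenius-norm error $\epsilon$ as soon as $$N\ \ge\ \frac{68}{\epsilon^2}\,4^k\,\log\!\Big(\frac{2(8n)^{2k}}{\delta}\Big)\,\max_O\Big\|O-\tfrac{\mathrm{tr}(O)}{4^n}I\Big\|_{\rm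 shadow}^2,$$ where $O$ ranges over the Pauli strings on the $2n$ qubits that act as the identity outside the input and output qubits of some $k$-element set $S$. In particular, random global Clifford measurements (a uniformly random Clifford unitary on all $2n$ qubits, then a computational-basis measurement) suffice for Frobenius-norm error $\epsilon$ when $$N\ge\frac{204}{\epsilon^2}\,4^{n+k}\log\!\Big(\frac{2(8n)^{2k}}{\delta}\Big),$$ and Pauli-6 POVM measurements (on every qubit, the six effects $\tfrac13|s\rangle\langle s|$ with $s$ running over the eigenvectors of $\sigma_x,\sigma_y,\sigma_z$) suffice for Frobenius-norm error $\epsilon$ when $$N\ge\frac{68}{\epsilon^2}\,36^{k}\log\!\Big(\frac{2(8n)^{2k}}{\delta}\Big).$$ (ii) Pauli-6 POVM measurements suffice for trace-norm error $\epsilon$ when $$N\ge\frac83\,\frac{144^k}{\epsilon^2}\,\log\!\Big(\frac{(24n)^{2k}}{\delta}\Big).$$ -/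

import Mathlib

open MeasureTheory
open scoped ComplexOrder

noncomputable section

namespace ShadowQPT

/-! ### Qubits, density matrices, norms -/

/-- Labels of the computational basis of the qubits `Q` (bit strings indexed by `Q`). -/
abbrev Bits (Q : Type) : Type := Q → Fin 2

/-- Operators on the Hilbert space of the qubits `Q`. -/
abbrev Op (Q : Type) : Type := Matrix (Bits Q) (Bits Q) ℂ

/-- Density matrices: positive semidefinite of trace one. -/
def IsDensity {Q : Type} [Fintype Q] [DecidableEq Q] (ρ : Op Q) : Prop :=
  ρ.PosSemidef ∧ ρ.trace = 1

/-- The rank-one operator `|ψ⟩⟨ψ|`. -/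
def ketbra {Q : Type} (ψ : Bits Q → ℂ) : Op Q :=
  Matrix.vecMulVec ψ (star ψ)

/-- The expectation `⟨ψ|A|ψ⟩`; only its real part is kept, it is real for Hermitian `A`. -/
def expect {Q : Type} [Fintype Q] [DecidableEq Q] (ψ : Bits Q → ℂ) (A : Op Q) : ℝ :=
  (star ψ ⬝ᵥ (A.mulVec ψ)).re

/-- The Frobenius (Hilbert–Schmidt) norm. -/
def frobNorm {Q : Type} [Fintype Q] [DecidableEq Q] (A : Op Q) : ℝ :=
  Real.sqrt (∑ x, ∑ y, ‖A x y‖ ^ 2)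

/-- The trace norm: the sum of the singular values, i.e. of the square roots of the
eigenvalues of `Aᴴ A`. -/
def traceNorm {Q : Type} [Fintype Q] [DecidableEq Q] (A : Op Q) : ℝ :=
  ∑ x, Real.sqrt ((Matrix.isHermitian_conjTranspose_mul_self A).eigenvalues x)

/-! ### Pauli strings -/

/-- The single-qubit matrices `I, X, Y, Z`, numbered `0, 1, 2, 3`. -/
def pauli1 : Fin 4 → Matrix (Fin 2) (Fin 2) ℂ :=
  ![1, !![0, 1; 1, 0], !![0, -Complex.I; Complex.I, 0], !![1, 0; 0, -1]]

/-- The Pauli string `⨂ q, pauli1 (P q)`. -/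
def pauliString {Q : Type} [Fintype Q] (P : Q → Fin 4) : Op Q :=
  Matrix.of fun x y => ∏ q, pauli1 (P q) (x q) (y q)

/-- A Pauli string on the qubits of `T`, extended by the identity to all qubits. -/
def extendPauli {Q : Type} [DecidableEq Q] (T : Finset Q) (P : T → Fin 4) : Q → Fin 4 :=
  fun q => if h : q ∈ T then P ⟨q, h⟩ else 0

/-! ### Reduced states -/

/-- The bit string on `Q` that is `a` on `T` and `c` off `T`. -/
def glue {Q : Type} [DecidableEq Q] (T : Finset Q) (a : Bits T) (c : Bits {q // q ∉ T}) :
    Bits Q :=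
  fun q => if h : q ∈ T then a ⟨q, h⟩ else c ⟨q, h⟩

/-- The partial trace over all qubits outside `T`. -/
def reduced {Q : Type} [Fintype Q] [DecidableEq Q] (T : Finset Q) (ρ : Op Q) : Op T :=
  Matrix.of fun a b => ∑ c : Bits {q // q ∉ T}, ρ (glue T a c) (glue T b c)

/-! ### Quantum processes and their Choi matrices -/

/-- `id ⊗ E` on `M_m ⊗ B`, where `E` acts on the operators of the `n` qubits. -/
def ampliate {n : ℕ} (E : Op (Fin n) →ₗ[ℂ] Op (Fin n)) (m : ℕ)
    (X : Matrix (Fin m × Bits (Fin n)) (Fin m × Bits (Fin n)) ℂ) :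
    Matrix (Fin m × Bits (Fin n)) (Fin m × Bits (Fin n)) ℂ :=
  Matrix.of fun p q => E (Matrix.of fun x y => X (p.1, x) (q.1, y)) p.2 q.2

/-- An `n`-qubit process: a completely positive trace-preserving linear map. -/
def IsChannel {n : ℕ} (E : Op (Fin n) →ₗ[ℂ] Op (Fin n)) : Prop :=
  (∀ (m : ℕ) (X : Matrix (Fin m × Bits (Fin n)) (Fin m × Bits (Fin n)) ℂ),
      X.PosSemidef → (ampliate E m X).PosSemidef) ∧
  ∀ X : Op (Fin n), (E X).trace = X.trace

/-- The `2n` qubits of a Choi matrix: `Sum.inl i` is the `i`-th input (ancilla) qubit and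
`Sum.inr i` is the `i`-th output qubit. -/
abbrev ChoiQubits (n : ℕ) : Type := Fin n ⊕ Fin n

/-- The normalized process Choi matrix `2⁻ⁿ ∑ x y, |x⟩⟨y| ⊗ E(|x⟩⟨y|)`, i.e. `id ⊗ E` applied to
`n` normalized Bell pairs. -/
def choi {n : ℕ} (E : Op (Fin n) →ₗ[ℂ] Op (Fin n)) : Op (ChoiQubits n) :=
  Matrix.of fun x y =>
    (2 ^ n : ℂ)⁻¹ *
      E (Matrix.single (x ∘ Sum.inl) (y ∘ Sum.inl) 1) (x ∘ Sum.inr) (y ∘ Sum.inr)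

/-- The input and output qubits of the subsystem `S`. -/
def bothSides {n : ℕ} (S : Finset (Fin n)) : Finset (ChoiQubits n) := S.disjSum S

/-! ### Measurement primitives and classical shadows -/

/-- The data of a rank-one measurement: with `w` the measure `weight` and `ψ` the map `state`, the
outcome `ω` has the effect `|ψ ω⟩⟨ψ ω| dw(ω)`. -/
structure MeasurementPrimitive (Q : Type) (Ω : Type*) [MeasurableSpace Ω] where
  weight : Measure Ω
  state : Ω → Bits Q → ℂ

namespace MeasurementPrimitive

variable {Q : Type} [Fintype Q] [DecidableEq Q] {Ω : Type*} [MeasurableSpace Ω]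

/-- The data form a POVM: the states are unit vectors that depend measurably on the outcome, and
the effects sum to the identity. -/
def IsPOVM (P : MeasurementPrimitive Q Ω) : Prop :=
  IsFiniteMeasure P.weight ∧ Measurable P.state ∧
  (∀ ω, ∑ x, ‖P.state ω x‖ ^ 2 = 1) ∧
  ∀ x y, ∫ ω, ketbra (P.state ω) x y ∂P.weight = (1 : Op Q) x y

/-- The law of the outcome of one measurement of the state `ρ` (Born rule). -/
def law (P : MeasurementPrimitive Q Ω) (ρ : Op Q) : Measure Ω :=
  P.weight.withDensity fun ω => ENNReal.ofReal (expect (P.state ω) ρ)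

/-- The measurement channel `M(X) = ∫ ⟨ψ|X|ψ⟩ |ψ⟩⟨ψ| dw`. -/
def shadowChannel (P : MeasurementPrimitive Q Ω) (X : Op Q) : Op Q :=
  Matrix.of fun x y =>
    ∫ ω, (star (P.state ω) ⬝ᵥ (X.mulVec (P.state ω))) * ketbra (P.state ω) x y ∂P.weight

/-- Tomographic completeness: the measurement channel is invertible. -/
def TomographicallyComplete (P : MeasurementPrimitive Q Ω) : Prop :=
  Function.Bijective P.shadowChannel

/-- The inverse measurement channel. -/
def invChannel (P : MeasurementPrimitive Q Ω) : Op Q → Op Q :=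
  Function.invFun P.shadowChannel

/-- The classical shadow `M⁻¹(|ψ⟩⟨ψ|)` of one measurement outcome. -/
def shadow (P : MeasurementPrimitive Q Ω) (ω : Ω) : Op Q :=
  P.invChannel (ketbra (P.state ω))

/-- The shadow norm: the square root of the maximum over all states `σ` of
`∫ ⟨ψ|σ|ψ⟩ ⟨ψ|M⁻¹(O)|ψ⟩² dw`. -/
def shadowNorm (P : MeasurementPrimitive Q Ω) (O : Op Q) : ℝ :=
  ⨆ σ : {σ : Op Q // IsDensity σ},
    Real.sqrt (∫ ω, expect (P.state ω) σ.1 * expect (P.state ω) (P.invChannel O) ^ 2 ∂P.weight)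

end MeasurementPrimitive

/-- The traceless part of an operator. -/
def traceless {Q : Type} [Fintype Q] [DecidableEq Q] (O : Op Q) : Op Q :=
  O - (O.trace / 2 ^ Fintype.card Q) • (1 : Op Q)

/-- The largest squared shadow norm of the traceless part of a Pauli observable that acts on the
`2k` input and output qubits of some `k`-qubit subsystem. -/
def maxShadowNormSq {n : ℕ} (k : ℕ) {Ω : Type*} [MeasurableSpace Ω]
    (P : MeasurementPrimitive (ChoiQubits n) Ω) : ℝ :=
  ⨆ p : (S : {S : Finset (Fin n) // S.card = k}) × (bothSides S.1 → Fin 4),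
    P.shadowNorm (traceless (pauliString (extendPauli (bothSides p.1.1) p.2))) ^ 2

/-! ### Two measurement primitives -/

/-- Draw a unitary `U g` with `g` distributed by `μ`, apply it, and measure all qubits in the
computational basis: the outcome `(g, b)` belongs to the vector `(U g)ᴴ |b⟩`. -/
def unitaryEnsemble {Q : Type} {G : Type*} [MeasurableSpace G] (μ : Measure G) (U : G → Op Q) :
    MeasurementPrimitive Q (G × Bits Q) where
  weight := μ.prod Measure.count
  state := fun ω x => star (U ω.1 ω.2 x)

/-- The global Clifford group: unitaries that map every Pauli string, by conjugation, to a Pauli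
string up to sign. The determinant is normalized to one, so that the group is finite and contains
the same number of representatives of every Clifford unitary up to a global phase. -/
def Clifford (Q : Type) [Fintype Q] [DecidableEq Q] : Type :=
  {U : Op Q // U ∈ Matrix.unitaryGroup (Bits Q) ℂ ∧ U.det = 1 ∧
    ∀ P : Q → Fin 4, ∃ P' : Q → Fin 4,
      U * pauliString P * U.conjTranspose = pauliString P' ∨
      U * pauliString P * U.conjTranspose = -pauliString P'}

instance (Q : Type) [Fintype Q] [DecidableEq Q] : MeasurableSpace (Clifford Q) := ⊤

/-- Random global Clifford measurement: a uniformly random Clifford unitary on all qubits, followed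
by a measurement in the computational basis. -/
def cliffordMeasurement (Q : Type) [Fintype Q] [DecidableEq Q] :
    MeasurementPrimitive Q (Clifford Q × Bits Q) :=
  unitaryEnsemble ((Nat.card (Clifford Q) : ENNReal)⁻¹ • Measure.count) (fun U => U.1)

/-- The six eigenvectors of the Pauli matrices: `|0⟩, |1⟩` (basis `0`), `|+⟩, |-⟩` (basis `1`) and
`|r⟩, |l⟩` (basis `2`). -/
def pauli6State : Fin 3 × Fin 2 → Fin 2 → ℂ
  | (0, s) => ![![1, 0], ![0, 1]] s
  | (1, s) => fun x => (Real.sqrt 2 : ℂ)⁻¹ * ![![1, 1], ![1, -1]] s x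
  | (2, s) => fun x => (Real.sqrt 2 : ℂ)⁻¹ * ![![1, Complex.I], ![1, -Complex.I]] s x

/-- The Pauli-6 POVM, with the effects `|s⟩⟨s| / 3`, on every qubit. -/
def pauli6Measurement (Q : Type) [Fintype Q] [DecidableEq Q] :
    MeasurementPrimitive Q (Q → Fin 3 × Fin 2) where
  weight := ((3 : ENNReal) ^ Fintype.card Q)⁻¹ • Measure.count
  state := fun ω x => ∏ q, pauli6State (ω q) (x q)

/-! ### The estimator and its sample complexity -/

/-- The median of `K + 1` real numbers (the average of the two middle ones if `K + 1` is even). -/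
def median {K : ℕ} (v : Fin (K + 1) → ℝ) : ℝ :=
  (v (Tuple.sort v ⟨K / 2, by omega⟩) + v (Tuple.sort v ⟨(K + 1) / 2, by omega⟩)) / 2

/-- Median of means: the `N` numbers are divided, by the residue of their index, into `K + 1`
batches whose sizes differ by at most one, and the median of the batch means is returned. For
`K = 0` this is the mean. -/
def medianOfMeans {N : ℕ} (K : ℕ) (v : Fin N → ℝ) : ℝ :=
  median fun j : Fin (K + 1) =>
    (∑ i with i.val % (K + 1) = j.val, v i) /
      (Finset.card {i : Fin N | i.val % (K + 1) = j.val} : ℝ)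

section Estimator

variable {Q : Type} [Fintype Q] [DecidableEq Q] {Ω : Type*} [MeasurableSpace Ω]

/-- The classical shadow estimate of `tr (O ρ)` from the outcomes `ω` of `N` measurements. -/
def estimate (P : MeasurementPrimitive Q Ω) {N : ℕ} (K : ℕ) (ω : Fin N → Ω) (O : Op Q) : ℝ :=
  medianOfMeans K fun i => (O * P.shadow (ω i)).trace.re

/-- The classical shadow estimate of the reduced state on `T`: its Pauli expansion with the
coefficients estimated by median of means. -/
def estimateReduced (P : MeasurementPrimitive Q Ω) {N : ℕ} (K : ℕ) (ω : Fin N → Ω)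
    (T : Finset Q) : Op T :=
  (2 ^ T.card : ℂ)⁻¹ • ∑ p : T → Fin 4,
    (estimate P K ω (pauliString (extendPauli T p)) : ℂ) • pauliString p

end Estimator

/-- `N` independent measurements of the process Choi matrix by `P` suffice to predict all reduced
`k`-qubit process Choi matrices simultaneously up to error `ε` in the norm `nrm` with probability
at least `1 - δ`: for a suitable number of batches, which does not depend on the process, the
classical shadow estimator achieves this for every `n`-qubit process. -/
def Suffices {n : ℕ} {Ω : Type*} [MeasurableSpace Ω] (P : MeasurementPrimitive (ChoiQubits n) Ω)
    (nrm : ∀ {Q : Type} [Fintype Q] [DecidableEq Q], Op Q → ℝ) (k : ℕ) (ε δ : ℝ) (N : ℕ) : Prop :=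
  ∃ K : ℕ, ∀ E : Op (Fin n) →ₗ[ℂ] Op (Fin n), IsChannel E →
    ENNReal.ofReal (1 - δ) ≤ Measure.pi (fun _ : Fin N => P.law (choi E))
      {ω | ∀ S : Finset (Fin n), S.card = k →
        nrm (estimateReduced P K ω (bothSides S) - reduced (bothSides S) (choi E)) ≤ ε}

end ShadowQPT

end

open ShadowQPT

noncomputable section

namespace ShadowQPT

/-! ### Algebra of Pauli strings -/

section Pauli

variable {Q : Type} [Fintype Q] [DecidableEq Q]

/-! The only fact about a process that matters is that its Choi matrix is a density matrix;
everything else is a statement about learning Pauli coefficients of an arbitrary state.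

Pauli strings are orthogonal with squared norm equal to the dimension, here `4^k`. Hence the squared
Frobenius error of the estimate is `4^(-k)` times the sum of the `16^k` squared coefficient errors
(`frobNorm_estimateReduced_sub_sq`), and it suffices to know each coefficient up to `ε / 2^k`. The
measurement channel is symmetric for the trace pairing, so `tr(O · shadow)` equals `⟨ψ|M⁻¹(O)|ψ⟩`:
an unbiased estimator of `tr(Oρ)` whose variance is at most the squared shadow norm of the traceless
part of `O`. Median of means over roughly `log(1/η)` batches turns this variance into failure
probability `η` (`medianOfMeans_tail`), and a union bound over at most `(16n)^k` pairs of subsystem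
and string finishes the general case (`suffices_of_tail`, `suffices_frobNorm`).

Both concrete primitives have a measurement channel that multiplies a string `s` by some `c s > 0`,
and in every state the second moment of `⟨ψ|s|ψ⟩` is again `c s` (`IsPauliDiagonal`). So the
relevant squared shadow norm is `1 / c s`. For Pauli-6 this is `3^w` with `w` the weight of `s`. For
global Cliffords on `m` qubits it is `2^m + 1` for nonidentity `s`: the group permutes nonidentity
strings transitively up to sign, and `2^m - 1` of the `4^m - 1` possible images are diagonal.

For the trace norm, Cauchy–Schwarz costs a factor `4^k`, so the sum of all squared coefficient
errors must be at most `ε²`. Tolerances proportional to the standard bound `√(3^w)` are used; since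
`∑ 3^w = (1 + 3·3)^(2k) = 100^k`, they are `ε √(3^w) / 10^k`. The Pauli-6 estimator is also bounded
by `3^w`, so a Bernstein-type bound for the plain mean (`mean_tail`) gives every string the same
exponent. -/

theorem pauli1_swap (i j k l : Fin 2) :
    ∑ a, pauli1 a i j * pauli1 a k l = if i = l ∧ j = k then 2 else 0 := by
  fin_cases i <;> fin_cases j <;> fin_cases k <;> fin_cases l <;>
    simp [pauli1, Fin.sum_univ_four, one_add_one_eq_two]

theorem pauli1_mul_trace (a b : Fin 4) :
    ∑ i, ∑ j, pauli1 a i j * pauli1 b j i = if a = b then 2 else 0 := by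
  fin_cases a <;> fin_cases b <;>
    simp [pauli1, Fin.sum_univ_two, one_add_one_eq_two]

theorem pauli1_conj (a : Fin 4) (i j : Fin 2) : star (pauli1 a j i) = pauli1 a i j := by
  fin_cases a <;> fin_cases i <;> fin_cases j <;> simp [pauli1]

theorem pauli1_mul_self (a : Fin 4) : pauli1 a * pauli1 a = 1 := by
  ext i j
  fin_cases a <;> fin_cases i <;> fin_cases j <;> simp [pauli1, Matrix.mul_apply]

/-- Read as two-bit numbers, the labels form the Klein four-group under xor. The phase is left
unspecified because only the label of a product is needed later. -/
theorem pauli1_mul (a b : Fin 4) :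
    ∃ c : ℂ, pauli1 a * pauli1 b = c • pauli1 (a ^^^ b) := by
  have h12 : (1 : Fin 4) ^^^ 2 = 3 := by decide
  have h13 : (1 : Fin 4) ^^^ 3 = 2 := by decide
  have h21 : (2 : Fin 4) ^^^ 1 = 3 := by decide
  have h23 : (2 : Fin 4) ^^^ 3 = 1 := by decide
  have h31 : (3 : Fin 4) ^^^ 1 = 2 := by decide
  have h32 : (3 : Fin 4) ^^^ 2 = 1 := by decide
  have h0 : ∀ a : Fin 4, 0 ^^^ a = a := by decide
  have h0' : ∀ a : Fin 4, a ^^^ 0 = a := by decide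
  have hs : ∀ a : Fin 4, a ^^^ a = 0 := by decide
  by_cases ha : a = 0
  · subst ha; rw [h0]; exact ⟨1, by simp [pauli1]⟩
  by_cases hb : b = 0
  · subst hb; rw [h0']; exact ⟨1, by simp [pauli1]⟩
  by_cases hab : a = b
  · subst hab; rw [hs]; exact ⟨1, by rw [pauli1_mul_self]; simp [pauli1]⟩
  fin_cases a <;> fin_cases b <;> simp at ha hb hab <;>
    simp only [Fin.mk_one, Fin.reduceFinMk, h12, h13, h21, h23, h31, h32] <;>
    first
      | (refine ⟨Complex.I, ?_⟩
         ext i j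
         fin_cases i <;> fin_cases j <;> simp [pauli1, Matrix.mul_apply]
         done)
      | (refine ⟨-Complex.I, ?_⟩
         ext i j
         fin_cases i <;> fin_cases j <;> simp [pauli1, Matrix.mul_apply])

/-- The commutation sign of two single-qubit Pauli matrices. -/
def pauliSign1 (a b : Fin 4) : ℂ := if a = 0 ∨ b = 0 ∨ a = b then 1 else -1

theorem pauli1_comm (a b : Fin 4) :
    pauli1 a * pauli1 b = pauliSign1 a b • (pauli1 b * pauli1 a) := by
  ext i j
  fin_cases a <;> fin_cases b <;> fin_cases i <;> fin_cases j <;>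
    simp [pauli1, Matrix.mul_apply, pauliSign1]

theorem pauliString_mul_apply (s t : Q → Fin 4) (x y : Bits Q) :
    (pauliString s * pauliString t) x y = ∏ q, (pauli1 (s q) * pauli1 (t q)) (x q) (y q) := by
  simp only [Matrix.mul_apply, pauliString, Matrix.of_apply]
  rw [Finset.prod_univ_sum, Fintype.piFinset_univ]
  exact Finset.sum_congr rfl fun z _ => Finset.prod_mul_distrib.symm

theorem prod_ite_all {ι : Type*} [Fintype ι] (p : ι → Prop) [DecidablePred p] (c : ℂ) :
    ∏ q, (if p q then c else 0) = if ∀ q, p q then c ^ Fintype.card ι else 0 := by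
  split_ifs with h
  · simp [h]
  · push Not at h
    obtain ⟨q, hq⟩ := h
    exact Finset.prod_eq_zero (Finset.mem_univ q) (by simp [hq])

/-- This is `∑ σ ⊗ σ = 2^|Q| · SWAP`, which factorizes over qubits. Contracting it with an operator
in two different ways yields the Pauli expansion and the Pauli twirl. -/
theorem pauliString_swap (x y z w : Bits Q) :
    ∑ s : Q → Fin 4, pauliString s x y * pauliString s z w =
      if x = w ∧ y = z then 2 ^ Fintype.card Q else 0 := by
  simp only [pauliString, Matrix.of_apply, ← Finset.prod_mul_distrib]
  have := Finset.prod_univ_sum (fun _ : Q => (Finset.univ : Finset (Fin 4)))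
    (fun q a => pauli1 a (x q) (y q) * pauli1 a (z q) (w q))
  rw [Fintype.piFinset_univ] at this
  rw [← this]
  simp only [pauli1_swap]
  rw [prod_ite_all]
  congr 1
  simp only [funext_iff, forall_and]

theorem pauliString_mul_trace (s t : Q → Fin 4) :
    (pauliString s * pauliString t).trace = if s = t then 2 ^ Fintype.card Q else 0 := by
  simp only [Matrix.trace, Matrix.diag_apply, pauliString_mul_apply]
  have := Finset.prod_univ_sum (fun _ : Q => (Finset.univ : Finset (Fin 2)))
    (fun q i => (pauli1 (s q) * pauli1 (t q)) i i)
  rw [Fintype.piFinset_univ] at this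
  rw [← this]
  simp only [Matrix.mul_apply, pauli1_mul_trace]
  rw [prod_ite_all]
  simp only [funext_iff]

omit [DecidableEq Q] in
theorem pauliString_zero : pauliString (0 : Q → Fin 4) = 1 := by
  ext x y
  simp only [pauliString, Matrix.of_apply, Pi.zero_apply, pauli1, Matrix.cons_val_zero,
    Matrix.one_apply]
  rw [prod_ite_all]
  simp [funext_iff]

omit [DecidableEq Q] in
theorem pauliString_isHermitian (s : Q → Fin 4) : (pauliString s).IsHermitian := by
  ext x y
  simp only [Matrix.conjTranspose_apply, pauliString, Matrix.of_apply, star_prod, pauli1_conj]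

theorem pauliString_mul_self (s : Q → Fin 4) : pauliString s * pauliString s = 1 := by
  ext x y
  rw [pauliString_mul_apply, ← pauliString_zero]
  simp only [pauli1_mul_self]
  simp [pauliString, pauli1]

theorem pauliString_trace {s : Q → Fin 4} (hs : s ≠ 0) : (pauliString s).trace = 0 := by
  have := pauliString_mul_trace s 0
  rwa [pauliString_zero, mul_one, if_neg hs] at this

theorem pauliString_mul (s t : Q → Fin 4) :
    ∃ c : ℂ, pauliString s * pauliString t = c • pauliString (fun q => s q ^^^ t q) := by
  choose c hc using pauli1_mul
  refine ⟨∏ q, c (s q) (t q), ?_⟩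
  ext x y
  rw [pauliString_mul_apply]
  simp [hc, pauliString, Finset.prod_mul_distrib]

/-- The commutation sign of two Pauli strings. -/
def pauliSign (s t : Q → Fin 4) : ℂ := ∏ q, pauliSign1 (s q) (t q)

theorem pauliString_comm (s t : Q → Fin 4) :
    pauliString s * pauliString t = pauliSign s t • (pauliString t * pauliString s) := by
  ext x y
  rw [Matrix.smul_apply, pauliString_mul_apply, pauliString_mul_apply]
  simp only [pauliSign, smul_eq_mul, ← Finset.prod_mul_distrib]
  exact Finset.prod_congr rfl fun q _ => by rw [pauli1_comm]; rfl

omit [DecidableEq Q] in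
theorem pauliSign_eq (s t : Q → Fin 4) : pauliSign s t = 1 ∨ pauliSign s t = -1 := by
  have h : ∀ a b, pauliSign1 a b = 1 ∨ pauliSign1 a b = -1 := fun a b => by
    unfold pauliSign1; split_ifs <;> simp
  unfold pauliSign
  refine Finset.prod_induction _ (fun z : ℂ => z = 1 ∨ z = -1) ?_ (Or.inl rfl) fun q _ => h _ _
  rintro a b (rfl | rfl) (rfl | rfl) <;> simp

theorem sum_trace_smul_pauliString (A : Op Q) :
    ∑ s : Q → Fin 4, (pauliString s * A).trace • pauliString s =
      (2 ^ Fintype.card Q : ℂ) • A := by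
  ext x y
  simp only [Matrix.sum_apply, Matrix.smul_apply, Matrix.trace, Matrix.diag_apply,
    Matrix.mul_apply, smul_eq_mul, Finset.sum_mul]
  rw [Finset.sum_comm]
  have h : ∀ z, ∑ s : Q → Fin 4, ∑ w, pauliString s z w * A w z * pauliString s x y =
      ∑ w, (if z = y ∧ w = x then 2 ^ Fintype.card Q else 0) * A w z := by
    intro z
    rw [Finset.sum_comm]
    refine Finset.sum_congr rfl fun w _ => ?_
    rw [← pauliString_swap, Finset.sum_mul]
    exact Finset.sum_congr rfl fun s _ => by ring
  simp only [h, ite_and, ite_mul, zero_mul]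
  rw [Finset.sum_eq_single y, Finset.sum_eq_single x] <;> simp +contextual

theorem pauli_expansion (A : Op Q) :
    A = (2 ^ Fintype.card Q : ℂ)⁻¹ •
      ∑ s : Q → Fin 4, (pauliString s * A).trace • pauliString s := by
  rw [sum_trace_smul_pauliString, smul_smul, inv_mul_cancel₀ (by positivity), one_smul]

/-- The Pauli twirl is completely depolarizing. -/
theorem pauli_twirl (A : Op Q) :
    ∑ s : Q → Fin 4, pauliString s * A * pauliString s =
      (2 ^ Fintype.card Q * A.trace) • (1 : Op Q) := by
  ext x y
  simp only [Matrix.sum_apply, Matrix.mul_apply, Matrix.smul_apply, smul_eq_mul, Finset.sum_mul]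
  rw [Finset.sum_comm]
  have h : ∀ z, ∑ s : Q → Fin 4, ∑ w, pauliString s x w * A w z * pauliString s z y =
      ∑ w, (if x = y ∧ w = z then 2 ^ Fintype.card Q else 0) * A w z := by
    intro z
    rw [Finset.sum_comm]
    refine Finset.sum_congr rfl fun w _ => ?_
    rw [← pauliString_swap, Finset.sum_mul]
    exact Finset.sum_congr rfl fun s _ => by ring
  simp only [h, ite_and, ite_mul, zero_mul, Matrix.one_apply]
  by_cases hxy : x = y
  · simp [hxy, Matrix.trace, Finset.mul_sum]
  · simp [hxy]

/-- The twirl of such a `W` is a multiple of `W` itself, while every twirl is scalar. This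
irreducibility later shows that a Clifford unitary is determined by its action up to a scalar. -/
theorem eq_smul_one_of_commute_pauli {W : Op Q}
    (h : ∀ s, W * pauliString s = pauliString s * W) : ∃ c : ℂ, W = c • (1 : Op Q) := by
  have h1 := pauli_twirl W
  have h2 : ∀ s, pauliString s * W * pauliString s = W := fun s => by
    rw [← h, mul_assoc, pauliString_mul_self, mul_one]
  simp only [h2, Finset.sum_const, Finset.card_univ] at h1
  have h3 : (Fintype.card (Q → Fin 4) : ℂ) ≠ 0 := by
    exact_mod_cast Fintype.card_ne_zero
  rw [← Nat.cast_smul_eq_nsmul ℂ] at h1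
  exact ⟨(Fintype.card (Q → Fin 4) : ℂ)⁻¹ * (2 ^ Fintype.card Q * W.trace), by
    rw [mul_smul, ← h1, smul_smul, inv_mul_cancel₀ h3, one_smul]⟩

/-- Distinct strings are orthogonal, whereas a string has nonzero norm. This makes the label of a
conjugated string well defined. -/
theorem pauliString_label_unique {s t : Q → Fin 4} {c : ℂ}
    (h : pauliString s = c • pauliString t) : s = t := by
  by_contra hne
  have h1 := pauliString_mul_trace s s
  nth_rewrite 2 [h] at h1
  rw [Matrix.mul_smul, Matrix.trace_smul, pauliString_mul_trace, if_neg hne, if_pos rfl,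
    smul_zero] at h1
  exact absurd h1.symm (by positivity)

theorem frobNorm_sq (A : Op Q) : frobNorm A ^ 2 = (A.conjTranspose * A).trace.re := by
  unfold frobNorm
  rw [Real.sq_sqrt (by positivity)]
  simp only [Matrix.trace, Matrix.diag_apply, Matrix.mul_apply, Matrix.conjTranspose_apply,
    Complex.re_sum]
  rw [Finset.sum_comm]
  refine Finset.sum_congr rfl fun x _ => Finset.sum_congr rfl fun y _ => ?_
  rw [Complex.star_def, ← Complex.normSq_eq_conj_mul_self, Complex.ofReal_re,
    Complex.normSq_eq_norm_sq]

theorem frobNorm_sq_sum_pauliString (c : (Q → Fin 4) → ℝ) :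
    frobNorm (∑ s, (c s : ℂ) • pauliString s) ^ 2 = 2 ^ Fintype.card Q * ∑ s, c s ^ 2 := by
  rw [frobNorm_sq, Matrix.conjTranspose_sum, Finset.sum_mul_sum, Matrix.trace_sum]
  have h : ∀ s, (∑ t, ((c s : ℂ) • pauliString s).conjTranspose *
      ((c t : ℂ) • pauliString t)).trace = ((2 ^ Fintype.card Q * c s ^ 2 : ℝ) : ℂ) := by
    intro s
    rw [Matrix.trace_sum, Finset.sum_eq_single s]
    · rw [Matrix.conjTranspose_smul, (pauliString_isHermitian s).eq, Matrix.smul_mul,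
        Matrix.mul_smul, Matrix.trace_smul, Matrix.trace_smul, pauliString_mul_trace, if_pos rfl]
      simp
      ring
    · intro t _ hts
      rw [Matrix.conjTranspose_smul, (pauliString_isHermitian s).eq, Matrix.smul_mul,
        Matrix.mul_smul, Matrix.trace_smul, Matrix.trace_smul, pauliString_mul_trace,
        if_neg hts.symm]
      simp
    · simp
  simp only [h, Complex.re_sum, Complex.ofReal_re, Finset.mul_sum]

theorem frobNorm_nonneg (A : Op Q) : 0 ≤ frobNorm A := Real.sqrt_nonneg _

/-- Cauchy–Schwarz over the `2^|Q|` singular values. -/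
theorem traceNorm_sq_le (A : Op Q) :
    traceNorm A ^ 2 ≤ 2 ^ Fintype.card Q * frobNorm A ^ 2 := by
  have hH := Matrix.isHermitian_conjTranspose_mul_self A
  have h0 : ∀ x, 0 ≤ hH.eigenvalues x :=
    (Matrix.posSemidef_conjTranspose_mul_self A).eigenvalues_nonneg
  have h1 : traceNorm A ^ 2 ≤ Fintype.card (Bits Q) *
      ∑ x, Real.sqrt (hH.eigenvalues x) ^ 2 := by
    exact sq_sum_le_card_mul_sum_sq (s := Finset.univ)
      (f := fun x => Real.sqrt (hH.eigenvalues x))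
  have h2 : ∑ x, Real.sqrt (hH.eigenvalues x) ^ 2 = frobNorm A ^ 2 := by
    rw [frobNorm_sq, hH.trace_eq_sum_eigenvalues]
    simp [Real.sq_sqrt (h0 _)]
  rw [h2] at h1
  simpa using h1

end Pauli

/-! ### Concentration of empirical means and of medians of means -/

section Concentration

open ProbabilityTheory

/-- The median lies between the two middle order statistics. If it is too large, so is the upper one
and everything sorted above it; if too small, so is the lower one and everything below. Either way
at least half of the entries are off. -/
theorem median_deviation {K : ℕ} {v : Fin (K + 1) → ℝ} {m t : ℝ} (h : t < |median v - m|) :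
    K + 1 ≤ 2 * (Finset.univ.filter fun j => t ≤ |v j - m|).card := by
  have hmono := Tuple.monotone_sort v
  set σ := Tuple.sort v with hσ
  have key : ∀ s : Finset (Fin (K + 1)), (∀ j ∈ s, t ≤ |v (σ j) - m|) →
      s.card ≤ (Finset.univ.filter fun j => t ≤ |v j - m|).card := by
    intro s hs
    refine Finset.card_le_card_of_injOn σ (fun j hj => ?_) σ.injective.injOn
    simpa using hs j hj
  unfold median at h
  rw [← hσ] at h
  have hle : v (σ ⟨K / 2, by omega⟩) ≤ v (σ ⟨(K + 1) / 2, by omega⟩) :=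
    hmono (Fin.mk_le_mk.2 (by omega))
  rcases lt_abs.1 h with h | h
  · have := key (Finset.Ici ⟨(K + 1) / 2, by omega⟩) fun j hj => by
      have h2 : v (σ ⟨(K + 1) / 2, by omega⟩) ≤ v (σ j) := hmono (Finset.mem_Ici.1 hj)
      exact le_abs.2 (Or.inl (by linarith))
    rw [Fin.card_Ici] at this
    simp only at this
    omega
  · have := key (Finset.Iic ⟨K / 2, by omega⟩) fun j hj => by
      have h2 : v (σ j) ≤ v (σ ⟨K / 2, by omega⟩) := hmono (Finset.mem_Iic.1 hj)
      exact le_abs.2 (Or.inr (by linarith))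
    rw [Fin.card_Iic] at this
    simp only at this
    omega

/-- Events that depend on disjoint groups of independent variables are independent. -/
theorem measure_biInter_of_disjoint_groups {Ω ι J : Type*} [MeasurableSpace Ω] {μ : Measure Ω}
    [IsProbabilityMeasure μ] [DecidableEq ι] {X : ι → Ω → ℝ} (hX : ∀ i, Measurable (X i))
    (hind : iIndepFun X μ) (B : J → Finset ι) (hB : ∀ i j, i ≠ j → Disjoint (B i) (B j))
    (C : ∀ j, Set (B j → ℝ)) (hC : ∀ j, MeasurableSet (C j)) (T : Finset J) :
    μ (⋂ j ∈ T, (fun ω (i : B j) => X i ω) ⁻¹' C j) =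
      ∏ j ∈ T, μ ((fun ω (i : B j) => X i ω) ⁻¹' C j) := by
  classical
  induction T using Finset.induction_on with
  | empty => simp
  | insert j T hj ih =>
    rw [Finset.prod_insert hj, ← ih, Finset.set_biInter_insert]
    have hdis : Disjoint (B j) (T.biUnion B) := by
      rw [Finset.disjoint_biUnion_right]
      exact fun i hi => hB _ _ (by rintro rfl; exact hj hi)
    have h1 := hind.indepFun_finset (B j) (T.biUnion B) hdis hX
    have h2 : (⋂ i ∈ T, (fun ω (l : B i) => X l ω) ⁻¹' C i) =
        (fun ω (l : T.biUnion B) => X l ω) ⁻¹'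
          (⋂ i : T, (fun (z : T.biUnion B → ℝ) (l : B i) =>
            z ⟨l, Finset.mem_biUnion.2 ⟨i, i.2, l.2⟩⟩) ⁻¹' C i) := by
      ext ω
      simp
    rw [h2]
    refine h1.measure_inter_preimage_eq_mul _ _ (hC j) ?_
    refine MeasurableSet.iInter fun i => ?_
    exact measurable_pi_lambda _ (fun l => measurable_pi_apply _) (hC i)

theorem memLp_two_of_bounded {Ω : Type*} [MeasurableSpace Ω] {μ : Measure Ω} [IsFiniteMeasure μ]
    {X : Ω → ℝ} (hX : Measurable X) {R : ℝ} (hR : ∀ ω, |X ω| ≤ R) : MemLp X 2 μ :=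
  MemLp.of_bound hX.aestronglyMeasurable R (ae_of_all _ hR)

variable {Ω : Type*} [MeasurableSpace Ω] {ν : Measure Ω} [IsProbabilityMeasure ν] {X : Ω → ℝ}

/-- Chebyshev's inequality for one batch. The level `1/32` is small enough that half of the batches
failing, counted over all subsets of batches, still has probability at most `e^(-(K+1))`. -/
theorem batch_mean_tail (hX : Measurable X) {R : ℝ} (hR : ∀ ω, |X ω| ≤ R) {V t : ℝ}
    (hV : Var[X; ν] ≤ V) (ht : 0 < t) {N : ℕ} (s : Finset (Fin N)) (hs : 0 < s.card)
    (h : 32 * V ≤ s.card * t ^ 2) :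
    Measure.pi (fun _ : Fin N => ν)
      {ω | t ≤ |(∑ i ∈ s, X (ω i)) / s.card - ∫ ω, X ω ∂ν|} ≤ ENNReal.ofReal (1 / 32) := by
  set μ := Measure.pi (fun _ : Fin N => ν)
  have hm : ∀ i : Fin N, MemLp (fun ω : Fin N → Ω => X (ω i)) 2 μ := fun i =>
    memLp_two_of_bounded (hX.comp (measurable_pi_apply i)) fun ω => hR _
  have hind : iIndepFun (fun (i : Fin N) (ω : Fin N → Ω) => X (ω i)) μ :=
    iIndepFun_pi fun _ => hX.aemeasurable
  have hint : ∀ i : Fin N, ∫ ω, X (ω i) ∂μ = ∫ ω, X ω ∂ν := fun i =>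
    integral_comp_eval (μ := fun _ : Fin N => ν) hX.aestronglyMeasurable
  have hvar : ∀ i : Fin N, Var[fun ω : Fin N → Ω => X (ω i); μ] = Var[X; ν] := fun i =>
    (measurePreserving_eval (fun _ : Fin N => ν) i).variance_fun_comp hX.aemeasurable
  have hsR : (0 : ℝ) < s.card := by exact_mod_cast hs
  set Y : (Fin N → Ω) → ℝ := fun ω => (s.card : ℝ)⁻¹ * (∑ i ∈ s, fun ω : Fin N → Ω => X (ω i)) ω
    with hY
  have hYm : MemLp Y 2 μ := (memLp_finsetSum' s fun i _ => hm i).const_mul _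
  have hEY : ∫ ω, Y ω ∂μ = ∫ ω, X ω ∂ν := by
    simp only [hY, Finset.sum_apply]
    rw [integral_const_mul, integral_finsetSum _ fun i _ => (hm i).integrable (by norm_num)]
    simp only [hint, Finset.sum_const, nsmul_eq_mul]
    rw [inv_mul_cancel_left₀ hsR.ne']
  have hVY : Var[Y; μ] = Var[X; ν] / s.card := by
    rw [hY, variance_const_mul, IndepFun.variance_sum (fun i _ => hm i)
      (fun i _ j _ hij => hind.indepFun hij)]
    simp only [hvar, Finset.sum_const, nsmul_eq_mul]
    field_simp
  have hch := meas_ge_le_variance_div_sq hYm ht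
  rw [hEY, hVY] at hch
  have hset : {ω : Fin N → Ω | t ≤ |(∑ i ∈ s, X (ω i)) / s.card - ∫ ω, X ω ∂ν|} =
      {ω | t ≤ |Y ω - ∫ ω, X ω ∂ν|} := by
    ext ω
    simp only [hY, Finset.sum_apply, Set.mem_ofPred_eq, div_eq_inv_mul]
  rw [hset]
  refine hch.trans (ENNReal.ofReal_le_ofReal ?_)
  rw [div_div, div_le_div_iff₀ (by positivity) (by norm_num)]
  linarith

/-- The quotient map `i ↦ i / (K + 1)` sends the residue class of `j` onto at least all values below
`N / (K + 1)`. -/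
theorem batch_card_ge (N K j : ℕ) (hj : j < K + 1) :
    N / (K + 1) ≤ (Finset.univ.filter fun i : Fin N => i.val % (K + 1) = j).card := by
  rw [← Finset.card_range (N / (K + 1))]
  have hlt : ∀ l < N / (K + 1), l * (K + 1) + j < N := by
    intro l hl
    have h1 : (l + 1) * (K + 1) ≤ N / (K + 1) * (K + 1) := Nat.mul_le_mul_right _ hl
    have h2 := Nat.div_mul_le_self N (K + 1)
    nlinarith
  refine Finset.card_le_card_of_surjOn (fun i : Fin N => i.val / (K + 1)) fun l hl => ?_
  have hl' := hlt l (by simpa using hl)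
  refine ⟨⟨l * (K + 1) + j, hl'⟩, ?_, ?_⟩
  · simp [Nat.mod_eq_of_lt hj]
  · simp only
    rw [mul_comm, Nat.mul_add_div (by omega), Nat.div_eq_of_lt hj, add_zero]

/-- A bad median forces some set `T` of at least half of the batches to be bad simultaneously.
Batches are independent, so each `T` costs `(1/32)^|T|`, and there are at most `2^(K+1)` of them.
The hypothesis `hN` excludes empty batches. -/
theorem medianOfMeans_tail (hX : Measurable X) {R : ℝ} (hR : ∀ ω, |X ω| ≤ R) {V t : ℝ}
    (hV : Var[X; ν] ≤ V) (ht : 0 < t) {N K : ℕ} (hN : 0 < N / (K + 1))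
    (h : 32 * V ≤ (N / (K + 1) : ℕ) * t ^ 2) :
    Measure.pi (fun _ : Fin N => ν)
      {ω | t < |medianOfMeans K (fun i => X (ω i)) - ∫ ω, X ω ∂ν|} ≤
        ENNReal.ofReal (Real.exp (-(K + 1))) := by
  classical
  set μ := Measure.pi (fun _ : Fin N => ν)
  set B : Fin (K + 1) → Finset (Fin N) := fun j =>
    Finset.univ.filter fun i : Fin N => i.val % (K + 1) = j.val with hB
  have hBc : ∀ j, N / (K + 1) ≤ (B j).card := fun j => batch_card_ge N K j j.2
  set A : Fin (K + 1) → Set (Fin N → Ω) := fun j =>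
    {ω | t ≤ |(∑ i ∈ B j, X (ω i)) / (B j).card - ∫ ω, X ω ∂ν|} with hA
  have hAp : ∀ j, μ (A j) ≤ ENNReal.ofReal (1 / 32) := fun j =>
    batch_mean_tail hX hR hV ht (B j) (hN.trans_le (hBc j)) <| h.trans <| by
      gcongr
      exact hBc j
  have hind : iIndepFun (fun (i : Fin N) (ω : Fin N → Ω) => X (ω i)) μ :=
    iIndepFun_pi fun _ => hX.aemeasurable
  have hinter : ∀ T : Finset (Fin (K + 1)), μ (⋂ j ∈ T, A j) = ∏ j ∈ T, μ (A j) := by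
    intro T
    have := measure_biInter_of_disjoint_groups (fun i => hX.comp (measurable_pi_apply i)) hind B
      (fun i j hij => ?_)
      (fun j => {z : B j → ℝ | t ≤ |(∑ i, z i) / (B j).card - ∫ ω, X ω ∂ν|}) (fun j => ?_) T
    · have hAeq : ∀ j, (fun (ω : Fin N → Ω) (i : B j) => X (ω i)) ⁻¹'
          {z : B j → ℝ | t ≤ |(∑ i, z i) / (B j).card - ∫ ω, X ω ∂ν|} = A j := by
        intro j
        ext ω
        simp only [hA, Set.mem_preimage, Set.mem_ofPred_eq]
        rw [Finset.sum_coe_sort (B j) fun i => X (ω i)]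
      simp only [Function.comp_apply, hAeq] at this
      exact this
    · rw [Finset.disjoint_left]
      intro l hi hj
      simp only [hB, Finset.mem_filter, Finset.mem_univ, true_and] at hi hj
      exact hij (Fin.ext (hi.symm.trans hj))
    · exact measurableSet_le measurable_const (by fun_prop)
  set F := (Finset.univ : Finset (Finset (Fin (K + 1)))).filter fun T => K + 1 ≤ 2 * T.card
  have hsub : {ω | t < |medianOfMeans K (fun i => X (ω i)) - ∫ ω, X ω ∂ν|} ⊆
      ⋃ T ∈ F, ⋂ j ∈ T, A j := by
    intro ω hω
    have := median_deviation hω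
    simp only [Set.mem_iUnion]
    refine ⟨_, Finset.mem_filter.2 ⟨Finset.mem_univ _, this⟩, ?_⟩
    simp only [Set.mem_iInter, Finset.mem_filter, Finset.mem_univ, true_and]
    exact fun j hj => hj
  refine (measure_mono hsub).trans ((measure_biUnion_finset_le _ _).trans ?_)
  have hT : ∀ T ∈ F, μ (⋂ j ∈ T, A j) ≤
      ENNReal.ofReal ((1 / 2) ^ (K + 1) * Real.exp (-(K + 1))) := by
    intro T hTF
    have hTc : K + 1 ≤ 2 * T.card := (Finset.mem_filter.1 hTF).2
    rw [hinter]
    refine (Finset.prod_le_pow_card _ _ _ fun j _ => hAp j).trans ?_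
    rw [← ENNReal.ofReal_pow (by norm_num)]
    refine ENNReal.ofReal_le_ofReal ?_
    -- With `2|T| ≥ K + 1`, the factor `1/4` pays for the number of sets `T`, and `1/8 ≤ e^(-2)`
    -- supplies the exponential.
    have h1 : (1 / 32 : ℝ) ^ T.card = (1 / 4) ^ T.card * (1 / 8) ^ T.card := by
      rw [← mul_pow]; norm_num
    have h2 : (1 / 4 : ℝ) ^ T.card ≤ (1 / 2) ^ (K + 1) := by
      have : (1 / 4 : ℝ) ^ T.card = (1 / 2) ^ (2 * T.card) := by rw [pow_mul]; norm_num
      rw [this]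
      exact pow_le_pow_of_le_one (by norm_num) (by norm_num) hTc
    have h3 : (1 / 8 : ℝ) ≤ Real.exp (-2) := by
      rw [Real.exp_neg, one_div]
      refine inv_anti₀ (Real.exp_pos _) ?_
      have := Real.exp_one_lt_d9
      have h4 : Real.exp 2 = Real.exp 1 * Real.exp 1 := by rw [← Real.exp_add]; norm_num
      rw [h4]
      nlinarith [Real.exp_pos 1]
    have h5 : (1 / 8 : ℝ) ^ T.card ≤ Real.exp (-(K + 1)) := by
      refine (pow_le_pow_left₀ (by norm_num) h3 _).trans ?_
      rw [← Real.exp_nat_mul]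
      refine Real.exp_le_exp.2 ?_
      have : ((K + 1 : ℕ) : ℝ) ≤ (2 * T.card : ℕ) := by exact_mod_cast hTc
      push_cast at this
      linarith
    rw [h1]
    gcongr
  refine (Finset.sum_le_card_nsmul F _ _ hT).trans ?_
  have hF : F.card ≤ 2 ^ (K + 1) := (Finset.card_filter_le _ _).trans (by simp)
  rw [nsmul_eq_mul, ← ENNReal.ofReal_natCast, ← ENNReal.ofReal_mul (by positivity)]
  refine ENNReal.ofReal_le_ofReal ?_
  have hF' : (F.card : ℝ) ≤ 2 ^ (K + 1) := by exact_mod_cast hF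
  calc (F.card : ℝ) * ((1 / 2) ^ (K + 1) * Real.exp (-(K + 1)))
      ≤ 2 ^ (K + 1) * ((1 / 2) ^ (K + 1) * Real.exp (-(K + 1))) := by gcongr
    _ = Real.exp (-(K + 1)) := by
      rw [← mul_assoc, ← mul_pow]; norm_num

/-- The Taylor remainder is at most `(2/9)|x|³ ≤ x²/18`, and `1/2 + 1/18 < 3/5`. -/
theorem exp_le_quadratic {x : ℝ} (hx : |x| ≤ 1 / 4) : Real.exp x ≤ 1 + x + 3 / 5 * x ^ 2 := by
  have h := (abs_le.1 (Real.exp_bound (x := x) (by linarith) (n := 3) (by norm_num))).2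
  simp only [Finset.sum_range_succ, Finset.sum_range_zero, Nat.factorial] at h
  norm_num at h
  have h3 : |x| ^ 3 ≤ 1 / 4 * x ^ 2 := by
    rw [pow_succ, sq_abs, mul_comm]
    gcongr
  nlinarith [sq_nonneg x]

/-- Chernoff's method without centring: the quadratic bound on `exp` controls the moment generating
function by the mean and the raw second moment, which is the quantity known exactly for
Pauli-diagonal primitives. -/
theorem sum_upper_tail (hX : Measurable X) {R v l t : ℝ} (hR : ∀ ω, |X ω| ≤ R)
    (hv : ∫ ω, X ω ^ 2 ∂ν ≤ v) (hl : 0 ≤ l) (hlR : l * R ≤ 1 / 4) (N : ℕ) :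
    Measure.pi (fun _ : Fin N => ν) {ω | N * ((∫ ω, X ω ∂ν) + t) ≤ ∑ i, X (ω i)} ≤
      ENNReal.ofReal (Real.exp (N * (3 / 5 * l ^ 2 * v - l * t))) := by
  set μ := Measure.pi (fun _ : Fin N => ν)
  have hlX : ∀ ω, |l * X ω| ≤ 1 / 4 := fun ω => by
    rw [abs_mul, abs_of_nonneg hl]
    exact (mul_le_mul_of_nonneg_left (hR ω) hl).trans hlR
  have hXi : Integrable X ν := (memLp_two_of_bounded hX hR).integrable (by norm_num)
  have hX2 : Integrable (fun ω => X ω ^ 2) ν := (memLp_two_of_bounded hX hR).integrable_sq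
  have hexp : Integrable (fun ω => Real.exp (l * X ω)) ν :=
    Integrable.of_bound (by fun_prop) (Real.exp (1 / 4)) <| ae_of_all _ fun ω => by
      rw [Real.norm_eq_abs, Real.abs_exp]
      exact Real.exp_le_exp.2 ((le_abs_self _).trans (hlX ω))
  have hmgf : mgf X ν l ≤ Real.exp (l * (∫ ω, X ω ∂ν) + 3 / 5 * l ^ 2 * v) := by
    have h1 : mgf X ν l ≤ ∫ ω, (1 + l * X ω + 3 / 5 * l ^ 2 * X ω ^ 2) ∂ν := by
      refine integral_mono hexp (((integrable_const _).add (hXi.const_mul _)).add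
        (hX2.const_mul _)) fun ω => ?_
      have := exp_le_quadratic (hlX ω)
      simp only
      linarith [mul_pow l (X ω) 2]
    have h1' : ∫ ω, (1 + l * X ω + 3 / 5 * l ^ 2 * X ω ^ 2) ∂ν =
        (∫ ω, (1 : ℝ) ∂ν) + l * (∫ ω, X ω ∂ν) + 3 / 5 * l ^ 2 * ∫ ω, X ω ^ 2 ∂ν := by
      have hi : Integrable (fun ω => 1 + l * X ω) ν := (integrable_const _).add (hXi.const_mul _)
      rw [← integral_const_mul, ← integral_const_mul,
        ← integral_add (integrable_const _) (hXi.const_mul _),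
        ← integral_add hi (hX2.const_mul _)]
    rw [h1'] at h1
    simp only [integral_const, probReal_univ, smul_eq_mul, mul_one] at h1
    have h2 : 3 / 5 * l ^ 2 * ∫ ω, X ω ^ 2 ∂ν ≤ 3 / 5 * l ^ 2 * v := by gcongr
    have h3 := Real.add_one_le_exp (l * (∫ ω, X ω ∂ν) + 3 / 5 * l ^ 2 * v)
    linarith
  have hind : iIndepFun (fun (i : Fin N) (ω : Fin N → Ω) => X (ω i)) μ :=
    iIndepFun_pi fun _ => hX.aemeasurable
  have hsum : mgf (∑ i, fun ω : Fin N → Ω => X (ω i)) μ l = mgf X ν l ^ N := by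
    rw [hind.mgf_sum (fun i => hX.comp (measurable_pi_apply i))]
    have : ∀ i : Fin N, mgf (fun ω : Fin N → Ω => X (ω i)) μ l = mgf X ν l := fun i =>
      integral_comp_eval (μ := fun _ : Fin N => ν) (f := fun ω => Real.exp (l * X ω))
        (by fun_prop)
    simp [this]
  have hch := measure_ge_le_exp_mul_mgf (μ := μ) (X := ∑ i, fun ω : Fin N → Ω => X (ω i))
    (N * ((∫ ω, X ω ∂ν) + t)) hl (by
      refine hind.integrable_exp_mul_sum (fun i => hX.comp (measurable_pi_apply i)) fun i _ => ?_
      exact integrable_comp_eval (μ := fun _ : Fin N => ν) (f := fun ω => Real.exp (l * X ω)) hexp)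
  rw [hsum] at hch
  have h0 : 0 ≤ mgf X ν l := mgf_nonneg
  have hch' : μ.real {ω | N * ((∫ ω, X ω ∂ν) + t) ≤ ∑ i, X (ω i)} ≤
      Real.exp (N * (3 / 5 * l ^ 2 * v - l * t)) := by
    simp only [Finset.sum_apply] at hch
    refine hch.trans ((mul_le_mul_of_nonneg_left (pow_le_pow_left₀ h0 hmgf N)
      (Real.exp_pos _).le).trans ?_)
    rw [← Real.exp_nat_mul, ← Real.exp_add]
    refine le_of_eq (congrArg _ (by ring))
  rw [← ofReal_measureReal]
  exact ENNReal.ofReal_le_ofReal hch'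

theorem mean_tail (hX : Measurable X) {R v t : ℝ} (hR : ∀ ω, |X ω| ≤ R)
    (hv : ∫ ω, X ω ^ 2 ∂ν ≤ v) (hv0 : 0 < v) (ht : 0 < t) (htR : t * R ≤ 3 / 10 * v) {N : ℕ}
    (hN : 0 < N) :
    Measure.pi (fun _ : Fin N => ν) {ω | t < |(∑ i, X (ω i)) / N - ∫ ω, X ω ∂ν|} ≤
      ENNReal.ofReal (2 * Real.exp (-(N * t ^ 2 / (12 / 5 * v)))) := by
  -- This minimizes `(3/5) l² v - l t`, with value `-t² / ((12/5) v)`; the hypothesis `htR` is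
  -- exactly `l R ≤ 1/4`.
  set l := t / (6 / 5 * v) with hl
  have hl0 : 0 ≤ l := by positivity
  have hlR : l * R ≤ 1 / 4 := by
    rw [hl, div_mul_eq_mul_div, div_le_iff₀ (by positivity)]
    linarith
  have hexp : (N : ℝ) * (3 / 5 * l ^ 2 * v - l * t) = -(N * t ^ 2 / (12 / 5 * v)) := by
    rw [hl]; field_simp; ring
  have h1 := sum_upper_tail (t := t) hX hR hv hl0 hlR N
  have h2 := sum_upper_tail (X := fun ω => -X ω) (ν := ν) (t := t) hX.neg
    (fun ω => by rw [abs_neg]; exact hR ω) (by simpa using hv) hl0 hlR N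
  rw [hexp] at h1 h2
  have hNR : (0 : ℝ) < N := by exact_mod_cast hN
  refine (measure_mono (t := {ω | N * ((∫ ω, X ω ∂ν) + t) ≤ ∑ i, X (ω i)} ∪
    {ω | N * ((∫ ω, -X ω ∂ν) + t) ≤ ∑ i, -X (ω i)}) ?_).trans
    ((measure_union_le _ _).trans ?_)
  · intro ω hω
    simp only [Set.mem_ofPred_eq] at hω
    rcases lt_abs.1 hω with h | h
    · left
      have : (∫ ω, X ω ∂ν) + t ≤ (∑ i, X (ω i)) / N := by linarith
      rw [le_div_iff₀ hNR] at this
      simp only [Set.mem_ofPred_eq]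
      linarith
    · right
      have : (∑ i, X (ω i)) / N ≤ (∫ ω, X ω ∂ν) - t := by linarith
      rw [div_le_iff₀ hNR] at this
      simp only [Set.mem_ofPred_eq, integral_neg, Finset.sum_neg_distrib]
      linarith
  · refine (add_le_add h1 h2).trans ?_
    rw [← ENNReal.ofReal_add (Real.exp_pos _).le (Real.exp_pos _).le, two_mul]

theorem medianOfMeans_zero {N : ℕ} (v : Fin N → ℝ) : medianOfMeans 0 v = (∑ i, v i) / N := by
  have h : ∀ j : Fin 1, (Finset.univ.filter fun i : Fin N => i.val % (0 + 1) = j.val) =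
      Finset.univ := fun j => by
    ext i
    simp [Nat.mod_one]
  unfold medianOfMeans median
  simp only [h, Finset.card_univ, Fintype.card_fin]
  ring

end Concentration

/-! ### The measurement channel -/

namespace MeasurementPrimitive

section Channel

variable {Q : Type} [Fintype Q] [DecidableEq Q] {Ω : Type*} [MeasurableSpace Ω]

/-- The complex expectation `⟨ψ|A|ψ⟩` in the state of the outcome `ω`. -/
def ev (P : MeasurementPrimitive Q Ω) (A : Op Q) (ω : Ω) : ℂ :=
  star (P.state ω) ⬝ᵥ A.mulVec (P.state ω)

variable {P : MeasurementPrimitive Q Ω}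

theorem expect_eq_re_ev (A : Op Q) (ω : Ω) : expect (P.state ω) A = (P.ev A ω).re := rfl

theorem ev_eq_sum (A : Op Q) (ω : Ω) :
    P.ev A ω = ∑ x, ∑ y, A x y * ketbra (P.state ω) y x := by
  simp only [ev, dotProduct, Matrix.mulVec, ketbra, Matrix.vecMulVec_apply, Finset.mul_sum,
    Pi.star_apply]
  exact Finset.sum_congr rfl fun x _ => Finset.sum_congr rfl fun y _ => by ring

theorem ev_eq_trace (A : Op Q) (ω : Ω) : P.ev A ω = (A * ketbra (P.state ω)).trace := by
  rw [ev_eq_sum]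
  simp [Matrix.trace, Matrix.mul_apply]

theorem ev_smul (c : ℂ) (A : Op Q) (ω : Ω) : P.ev (c • A) ω = c * P.ev A ω := by
  simp [ev_eq_trace]

theorem ev_add (A B : Op Q) (ω : Ω) : P.ev (A + B) ω = P.ev A ω + P.ev B ω := by
  simp [ev_eq_trace, add_mul]

omit [Fintype Q] [DecidableEq Q] in
theorem ketbra_isHermitian (ψ : Bits Q → ℂ) : (ketbra ψ).IsHermitian := by
  ext x y
  simp [ketbra, Matrix.vecMulVec_apply, mul_comm]

theorem star_ev (A : Op Q) (ω : Ω) : star (P.ev A ω) = P.ev A.conjTranspose ω := by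
  rw [ev_eq_trace, ev_eq_trace, ← Matrix.trace_conjTranspose, Matrix.conjTranspose_mul,
    (ketbra_isHermitian _).eq, Matrix.trace_mul_comm]

theorem ev_eq_ofReal {A : Op Q} (hA : A.IsHermitian) (ω : Ω) :
    P.ev A ω = (expect (P.state ω) A : ℂ) := by
  have h := star_ev (P := P) A ω
  rw [hA.eq] at h
  exact (Complex.conj_eq_iff_re.1 h).symm

theorem expect_nonneg {A : Op Q} (hA : A.PosSemidef) (ω : Ω) : 0 ≤ expect (P.state ω) A := by
  have := hA.dotProduct_mulVec_nonneg (P.state ω)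
  exact (Complex.le_def.1 this).1

/-! ### Bounds, measurability and the trace pairing of the measurement channel. -/

section POVM

variable (hP : P.IsPOVM)
include hP

theorem IsPOVM.norm_state_le (ω : Ω) (x : Bits Q) : ‖P.state ω x‖ ≤ 1 := by
  have h1 := hP.2.2.1 ω
  have h2 := Finset.single_le_sum (f := fun x => ‖P.state ω x‖ ^ 2) (fun _ _ => by positivity)
    (Finset.mem_univ x)
  rw [h1] at h2
  exact (sq_le_one_iff₀ (norm_nonneg _)).1 h2

theorem IsPOVM.norm_ketbra_le (ω : Ω) (x y : Bits Q) : ‖ketbra (P.state ω) x y‖ ≤ 1 := by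
  rw [ketbra, Matrix.vecMulVec_apply, Pi.star_apply, norm_mul, norm_star]
  exact mul_le_one₀ (hP.norm_state_le ω x) (norm_nonneg _) (hP.norm_state_le ω y)

theorem IsPOVM.measurable_ketbra (x y : Bits Q) :
    Measurable fun ω => ketbra (P.state ω) x y := by
  have h : ∀ x, Measurable fun ω => P.state ω x := fun x => (measurable_pi_apply x).comp hP.2.1
  simp only [ketbra, Matrix.vecMulVec_apply, Pi.star_apply]
  exact (h x).mul (continuous_star.measurable.comp (h y))

theorem IsPOVM.measurable_ev (A : Op Q) : Measurable (P.ev A) := by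
  have : P.ev A = fun ω => ∑ x, ∑ y, A x y * ketbra (P.state ω) y x := funext (ev_eq_sum A)
  rw [this]
  exact Finset.measurable_sum _ fun x _ => Finset.measurable_sum _ fun y _ =>
    (hP.measurable_ketbra y x).const_mul _

theorem IsPOVM.measurable_expect (A : Op Q) : Measurable fun ω => expect (P.state ω) A :=
  Complex.measurable_re.comp (hP.measurable_ev A)

theorem IsPOVM.norm_ev_le (A : Op Q) (ω : Ω) : ‖P.ev A ω‖ ≤ ∑ x, ∑ y, ‖A x y‖ := by
  rw [ev_eq_sum]
  refine (norm_sum_le _ _).trans (Finset.sum_le_sum fun x _ => (norm_sum_le _ _).trans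
    (Finset.sum_le_sum fun y _ => ?_))
  rw [norm_mul]
  exact mul_le_of_le_one_right (norm_nonneg _) (hP.norm_ketbra_le ω y x)

theorem IsPOVM.abs_expect_le (A : Op Q) (ω : Ω) :
    |expect (P.state ω) A| ≤ ∑ x, ∑ y, ‖A x y‖ :=
  (Complex.abs_re_le_norm _).trans (hP.norm_ev_le A ω)

theorem IsPOVM.integrable_ketbra (x y : Bits Q) :
    Integrable (fun ω => ketbra (P.state ω) x y) P.weight :=
  have := hP.1
  Integrable.of_bound (hP.measurable_ketbra x y).aestronglyMeasurable 1
    (ae_of_all _ fun ω => hP.norm_ketbra_le ω x y)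

theorem IsPOVM.integrable_ev (A : Op Q) : Integrable (P.ev A) P.weight :=
  have := hP.1
  Integrable.of_bound (hP.measurable_ev A).aestronglyMeasurable _
    (ae_of_all _ fun ω => hP.norm_ev_le A ω)

theorem IsPOVM.integrable_ev_mul {f : Ω → ℂ} (hf : Integrable f P.weight) (A : Op Q) :
    Integrable (fun ω => P.ev A ω * f ω) P.weight :=
  hf.bdd_mul (hP.measurable_ev A).aestronglyMeasurable (ae_of_all _ fun ω => hP.norm_ev_le A ω)

theorem IsPOVM.integral_ev (A : Op Q) : ∫ ω, P.ev A ω ∂P.weight = A.trace := by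
  have hi : ∀ x y, Integrable (fun ω => A x y * ketbra (P.state ω) y x) P.weight :=
    fun x y => (hP.integrable_ketbra y x).const_mul _
  simp only [ev_eq_sum]
  rw [integral_finsetSum _ fun x _ => integrable_finsetSum _ fun y _ => hi x y]
  refine Finset.sum_congr rfl fun x _ => ?_
  rw [integral_finsetSum _ fun y _ => hi x y]
  simp only [integral_const_mul, hP.2.2.2, Matrix.one_apply]
  simp

/-- The right side is symmetric in `A` and `B`, so the channel, and hence its inverse, is
self-adjoint for the trace pairing. Unbiasedness rests on this. -/
theorem IsPOVM.trace_mul_shadowChannel (A B : Op Q) :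
    (B * P.shadowChannel A).trace = ∫ ω, P.ev A ω * P.ev B ω ∂P.weight := by
  have hi : ∀ x y, Integrable (fun ω => P.ev A ω * (B x y * ketbra (P.state ω) y x)) P.weight :=
    fun x y => hP.integrable_ev_mul ((hP.integrable_ketbra y x).const_mul _) A
  simp only [ev_eq_sum B, Finset.mul_sum]
  rw [integral_finsetSum _ fun x _ => integrable_finsetSum _ fun y _ => hi x y]
  simp only [Matrix.trace, Matrix.diag_apply, Matrix.mul_apply]
  refine Finset.sum_congr rfl fun x _ => ?_
  rw [integral_finsetSum _ fun y _ => hi x y]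
  refine Finset.sum_congr rfl fun y _ => ?_
  rw [shadowChannel, Matrix.of_apply, ← integral_const_mul]
  exact integral_congr_ae (ae_of_all _ fun ω => by simp only [ev]; ring)

theorem IsPOVM.shadowChannel_add (A B : Op Q) :
    P.shadowChannel (A + B) = P.shadowChannel A + P.shadowChannel B := by
  ext x y
  have h := fun A => hP.integrable_ev_mul (hP.integrable_ketbra x y) A
  have := integral_add (h A) (h B)
  simp only [← add_mul, ← ev_add] at this
  exact this

omit hP in
theorem shadowChannel_smul (c : ℂ) (A : Op Q) :
    P.shadowChannel (c • A) = c • P.shadowChannel A := by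
  ext x y
  have := integral_const_mul (μ := P.weight) c (fun ω => P.ev A ω * ketbra (P.state ω) x y)
  simp only [← mul_assoc, ← ev_smul] at this
  exact this

omit hP in
theorem shadowChannel_conjTranspose (A : Op Q) :
    P.shadowChannel A.conjTranspose = (P.shadowChannel A).conjTranspose := by
  ext x y
  have h : ∀ ω, P.ev A.conjTranspose ω * ketbra (P.state ω) x y =
      star (P.ev A ω * ketbra (P.state ω) y x) := fun ω => by
    rw [star_mul', star_ev, (ketbra_isHermitian _).apply]
  have h2 : ∫ ω, P.ev A.conjTranspose ω * ketbra (P.state ω) x y ∂P.weight =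
      star (∫ ω, P.ev A ω * ketbra (P.state ω) y x ∂P.weight) := by
    simp only [h]
    exact integral_conj
  exact h2

/-- The measurement channel of a POVM as a linear map. -/
def IsPOVM.shadowChannelLin : Op Q →ₗ[ℂ] Op Q where
  toFun := P.shadowChannel
  map_add' := hP.shadowChannel_add
  map_smul' := shadowChannel_smul

end POVM

/-! ### Classical shadows and the inverse channel. -/

section Complete

variable (hP : P.IsPOVM) (hT : P.TomographicallyComplete)
include hT

theorem shadowChannel_invChannel (O : Op Q) : P.shadowChannel (P.invChannel O) = O :=
  Function.rightInverse_invFun hT.2 O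

theorem invChannel_isHermitian {O : Op Q} (hO : O.IsHermitian) :
    (P.invChannel O).IsHermitian := by
  refine hT.1 ?_
  rw [shadowChannel_conjTranspose, shadowChannel_invChannel hT, hO.eq]

include hP in
-- Symmetry moves the inverse channel from the outcome projector to the observable, so the
-- single-shot estimator is the expectation of one fixed operator.
theorem trace_mul_shadow (O : Op Q) (ω : Ω) :
    (O * P.shadow ω).trace = P.ev (P.invChannel O) ω := by
  have h1 : P.shadowChannel (P.shadow ω) = ketbra (P.state ω) := shadowChannel_invChannel hT _
  conv_lhs => rw [← shadowChannel_invChannel hT O, Matrix.trace_mul_comm]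
  rw [hP.trace_mul_shadowChannel, ev_eq_trace, ← h1, hP.trace_mul_shadowChannel]
  exact integral_congr_ae (ae_of_all _ fun ω => mul_comm _ _)

include hP in
theorem re_trace_mul_shadow (O : Op Q) (ω : Ω) :
    (O * P.shadow ω).trace.re = expect (P.state ω) (P.invChannel O) := by
  rw [trace_mul_shadow hP hT, expect_eq_re_ev]

end Complete

/-! ### The outcome law -/

section Law

variable (hP : P.IsPOVM) {ρ : Op Q} (hρ : IsDensity ρ)
include hP hρ

theorem integral_law (f : Ω → ℝ) :
    ∫ ω, f ω ∂P.law ρ = ∫ ω, expect (P.state ω) ρ * f ω ∂P.weight := by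
  rw [law, integral_withDensity_eq_integral_toReal_smul
    (hP.measurable_expect ρ).ennreal_ofReal (ae_of_all _ fun _ => ENNReal.ofReal_lt_top)]
  exact integral_congr_ae (ae_of_all _ fun ω => by
    simp only [ENNReal.toReal_ofReal (expect_nonneg hρ.1 ω), smul_eq_mul])

theorem integral_expect : ∫ ω, expect (P.state ω) ρ ∂P.weight = 1 := by
  have h := hP.integral_ev ρ
  simp only [ev_eq_ofReal hρ.1.isHermitian, integral_complex_ofReal, hρ.2] at h
  exact_mod_cast h

theorem isProbabilityMeasure_law : IsProbabilityMeasure (P.law ρ) := by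
  have hi : Integrable (fun ω => expect (P.state ω) ρ) P.weight := (hP.integrable_ev ρ).re
  refine ⟨?_⟩
  rw [law, withDensity_apply _ MeasurableSet.univ, Measure.restrict_univ,
    ← ofReal_integral_eq_lintegral_ofReal hi (ae_of_all _ (expect_nonneg hρ.1)),
    integral_expect hP hρ, ENNReal.ofReal_one]

/-- Unbiasedness of the shadow estimator: the Born weight turns the mean into the trace pairing of
`M⁻¹(O)` with `M(ρ)`. -/
theorem integral_law_invChannel (hT : P.TomographicallyComplete) {O : Op Q}
    (hO : O.IsHermitian) :
    ((∫ ω, expect (P.state ω) (P.invChannel O) ∂P.law ρ : ℝ) : ℂ) = (O * ρ).trace := by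
  rw [integral_law hP hρ, ← integral_complex_ofReal]
  simp only [Complex.ofReal_mul, ← ev_eq_ofReal hρ.1.isHermitian,
    ← ev_eq_ofReal (invChannel_isHermitian hT hO)]
  conv_rhs => rw [← shadowChannel_invChannel hT O, Matrix.trace_mul_comm]
  rw [hP.trace_mul_shadowChannel]
  exact integral_congr_ae (ae_of_all _ fun ω => mul_comm _ _)

end Law

/-! ### The shadow norm -/

section ShadowNorm

variable (hP : P.IsPOVM)
include hP

theorem integrable_expect_mul {f : Ω → ℝ} (hf : Measurable f) {C : ℝ} (hC : ∀ ω, |f ω| ≤ C)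
    (A : Op Q) : Integrable (fun ω => expect (P.state ω) A * f ω) P.weight :=
  have hi : Integrable (fun ω => expect (P.state ω) A) P.weight := (hP.integrable_ev A).re
  hi.mul_bdd hf.aestronglyMeasurable (ae_of_all _ hC)

/-- A real supremum of an unbounded family has default value `0`, so boundedness is needed before
the shadow norm can dominate any single state. -/
theorem bddAbove_shadowNorm (O : Op Q) :
    BddAbove (Set.range fun σ : {σ : Op Q // IsDensity σ} =>
      Real.sqrt (∫ ω, expect (P.state ω) σ.1 * expect (P.state ω) (P.invChannel O) ^ 2
        ∂P.weight)) := by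
  set A := P.invChannel O
  set C := ∑ x, ∑ y, ‖A x y‖
  have hC : ∀ ω, expect (P.state ω) A ^ 2 ≤ C ^ 2 := fun ω =>
    sq_le_sq' (abs_le.1 (hP.abs_expect_le A ω)).1 (abs_le.1 (hP.abs_expect_le A ω)).2
  refine ⟨Real.sqrt (C ^ 2), ?_⟩
  rintro _ ⟨σ, rfl⟩
  refine Real.sqrt_le_sqrt ?_
  have h1 : ∫ ω, expect (P.state ω) σ.1 * expect (P.state ω) A ^ 2 ∂P.weight ≤
      ∫ ω, expect (P.state ω) σ.1 * C ^ 2 ∂P.weight := by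
    refine integral_mono (integrable_expect_mul hP ((hP.measurable_expect A).pow_const 2)
      (C := C ^ 2) (fun ω => ?_) _)
      (integrable_expect_mul hP measurable_const (fun _ => le_rfl) _) fun ω =>
        mul_le_mul_of_nonneg_left (hC ω) (expect_nonneg σ.2.1 ω)
    rw [abs_of_nonneg (sq_nonneg _)]
    exact hC ω
  rwa [integral_mul_const, integral_expect hP σ.2, one_mul] at h1

theorem integral_sq_le_shadowNorm_sq {σ : Op Q} (hσ : IsDensity σ) (O : Op Q) :
    ∫ ω, expect (P.state ω) σ * expect (P.state ω) (P.invChannel O) ^ 2 ∂P.weight ≤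
      P.shadowNorm O ^ 2 :=
  (Real.sqrt_le_iff.1 (le_ciSup (bddAbove_shadowNorm hP O) ⟨σ, hσ⟩)).2

omit hP in
theorem shadowNorm_sq_le {O : Op Q} {c : ℝ} (hc : 0 ≤ c)
    (h : ∀ σ : Op Q, IsDensity σ →
      ∫ ω, expect (P.state ω) σ * expect (P.state ω) (P.invChannel O) ^ 2 ∂P.weight ≤ c) :
    P.shadowNorm O ^ 2 ≤ c := by
  have h1 : P.shadowNorm O ≤ Real.sqrt c :=
    Real.iSup_le (fun σ => Real.sqrt_le_sqrt (h σ.1 σ.2)) (Real.sqrt_nonneg _)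
  have h0 : 0 ≤ P.shadowNorm O := Real.iSup_nonneg fun σ => Real.sqrt_nonneg _
  calc P.shadowNorm O ^ 2 ≤ Real.sqrt c ^ 2 := by gcongr
    _ = c := Real.sq_sqrt hc

omit hP in
theorem shadowNorm_zero_sq (hP : P.IsPOVM) (hT : P.TomographicallyComplete) :
    P.shadowNorm 0 ^ 2 ≤ 0 := by
  have h0 : P.invChannel 0 = 0 := hT.1 <| by
    rw [shadowChannel_invChannel hT]
    exact (hP.shadowChannelLin.map_zero).symm
  refine shadowNorm_sq_le le_rfl fun σ _ => ?_
  simp [h0, expect]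

theorem ev_one (ω : Ω) : P.ev 1 ω = 1 := by
  rw [ev, Matrix.one_mulVec, dotProduct]
  have := congrArg (fun r : ℝ => (r : ℂ)) (hP.2.2.1 ω)
  simpa [← Complex.conj_mul'] using this

theorem shadowChannel_one : P.shadowChannel 1 = 1 := by
  ext x y
  rw [← hP.2.2.2 x y]
  refine integral_congr_ae (ae_of_all _ fun ω => ?_)
  have := ev_one hP ω
  simp only [ev] at this
  simp only [this, one_mul]

theorem expect_one (ω : Ω) : expect (P.state ω) 1 = 1 := by
  rw [expect_eq_re_ev, ev_one hP, Complex.one_re]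

theorem expect_le_one_of_involution {O : Op Q} (hO : O.IsHermitian) (hO2 : O * O = 1) (ω : Ω) :
    expect (P.state ω) O ≤ 1 := by
  have h1 : ((1 - O).conjTranspose * (1 - O)) = (2 : ℂ) • (1 + (-1 : ℂ) • O) := by
    rw [Matrix.conjTranspose_sub, Matrix.conjTranspose_one, hO.eq]
    simp only [sub_mul, mul_sub, hO2, one_mul, mul_one, two_smul, neg_one_smul]
    abel
  have h2 := expect_nonneg (P := P) (Matrix.posSemidef_conjTranspose_mul_self (1 - O)) ω
  rw [expect_eq_re_ev, h1, ev_smul, ev_add, ev_smul, ev_one hP] at h2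
  rw [expect_eq_re_ev]
  simp at h2
  linarith

theorem abs_expect_le_one_of_involution {O : Op Q} (hO : O.IsHermitian) (hO2 : O * O = 1)
    (ω : Ω) : |expect (P.state ω) O| ≤ 1 := by
  refine abs_le.2 ⟨?_, expect_le_one_of_involution hP hO hO2 ω⟩
  have h := expect_le_one_of_involution hP (O := -O) hO.neg (by simpa using hO2) ω
  have h2 : expect (P.state ω) (-O) = -expect (P.state ω) O := by
    rw [expect_eq_re_ev, expect_eq_re_ev, ← neg_one_smul ℂ O, ev_smul]
    simp
  linarith

/-- Test on the maximally mixed state. With `a`, `o` the expectations of `M⁻¹(O)` and `O`, one has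
`a² ≥ 2ao - o² ≥ 2ao - 1`; the integrals of `ao` and of `1` both equal the dimension. The bound
ensures that the sample size in the general statement leaves no batch empty. -/
theorem one_le_shadowNorm_sq (hT : P.TomographicallyComplete) {O : Op Q} (hO : O.IsHermitian)
    (hO2 : O * O = 1) : 1 ≤ P.shadowNorm O ^ 2 := by
  set A := P.invChannel O with hA
  have hAH : A.IsHermitian := invChannel_isHermitian hT hO
  set d : ℝ := ((Fintype.card (Bits Q) : ℕ) : ℝ) with hd
  have hd0 : 0 < d := by rw [hd]; exact_mod_cast Fintype.card_pos
  have hdtr : (1 : Op Q).trace = (d : ℂ) := by simp [Matrix.trace_one, hd]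
  have hσ : IsDensity ((d : ℂ)⁻¹ • (1 : Op Q)) := by
    refine ⟨Matrix.PosSemidef.one.smul ?_, ?_⟩
    · rw [← Complex.ofReal_inv]
      exact_mod_cast (inv_pos.2 hd0).le
    · rw [Matrix.trace_smul, hdtr, smul_eq_mul]
      exact inv_mul_cancel₀ (by exact_mod_cast hd0.ne')
  refine le_trans ?_ (integral_sq_le_shadowNorm_sq hP hσ O)
  have h1 : ∀ ω, expect (P.state ω) ((d : ℂ)⁻¹ • (1 : Op Q)) = d⁻¹ := fun ω => by
    rw [expect_eq_re_ev, ev_smul, ev_one hP, mul_one, ← Complex.ofReal_inv, Complex.ofReal_re]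
  simp only [h1]
  rw [integral_const_mul]
  have hcross : ∫ ω, expect (P.state ω) A * expect (P.state ω) O ∂P.weight = d := by
    have h := hP.trace_mul_shadowChannel A O
    rw [shadowChannel_invChannel hT, hO2, hdtr] at h
    simp only [ev_eq_ofReal hAH, ev_eq_ofReal hO, ← Complex.ofReal_mul,
      integral_complex_ofReal] at h
    exact_mod_cast h.symm
  have hone : ∫ _ω, (1 : ℝ) ∂P.weight = d := by
    have h := hP.integral_ev 1
    simp only [ev_one hP, hdtr] at h
    have h2 : ∫ _ω, ((1 : ℝ) : ℂ) ∂P.weight = (d : ℂ) := by simpa using h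
    rw [integral_complex_ofReal] at h2
    exact_mod_cast h2
  have hfin := hP.1
  have hAi : Integrable (fun ω => expect (P.state ω) A ^ 2) P.weight := by
    simp only [pow_two]
    exact integrable_expect_mul hP (hP.measurable_expect A) (hP.abs_expect_le A) A
  have hci := integrable_expect_mul hP (hP.measurable_expect O) (hP.abs_expect_le O) A
  have hle : ∫ ω, (2 * (expect (P.state ω) A * expect (P.state ω) O) - 1) ∂P.weight ≤
      ∫ ω, expect (P.state ω) A ^ 2 ∂P.weight := by
    refine integral_mono ((hci.const_mul 2).sub (integrable_const 1)) hAi fun ω => ?_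
    have h2 := abs_expect_le_one_of_involution hP hO hO2 ω
    have h3 : expect (P.state ω) O ^ 2 ≤ 1 := (sq_le_one_iff_abs_le_one _).2 h2
    simp only
    nlinarith [sq_nonneg (expect (P.state ω) A - expect (P.state ω) O)]
  rw [integral_sub (hci.const_mul 2) (integrable_const 1), integral_const_mul, hcross, hone] at hle
  rw [inv_mul_eq_div, le_div_iff₀ hd0]
  linarith

end ShadowNorm

end Channel

end MeasurementPrimitive

/-! ### Choi matrices and reduced states -/

section Choi

variable {n : ℕ} {E : Op (Fin n) →ₗ[ℂ] Op (Fin n)}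

/-- Up to normalization and relabelling, the Choi matrix is the ampliation applied to the projector
on the unnormalized maximally entangled vector `v`. The ancilla basis is enumerated by `e` because
ampliations are indexed by `Fin m`. -/
theorem choi_posSemidef (hE : IsChannel E) : (choi E).PosSemidef := by
  set e := Fintype.equivFin (Bits (Fin n))
  set v : Fin (Fintype.card (Bits (Fin n))) × Bits (Fin n) → ℂ :=
    fun p => if p.1 = e p.2 then 1 else 0 with hv
  have h1 := hE.1 _ _ (Matrix.posSemidef_vecMulVec_self_star v)
  have h2 := h1.submatrix fun x : Bits (ChoiQubits n) => (e (x ∘ Sum.inl), x ∘ Sum.inr)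
  have h3 : choi E = ((2 ^ n : ℂ)⁻¹) • (ampliate E _ (Matrix.vecMulVec v (star v))).submatrix
      (fun x : Bits (ChoiQubits n) => (e (x ∘ Sum.inl), x ∘ Sum.inr))
      (fun x : Bits (ChoiQubits n) => (e (x ∘ Sum.inl), x ∘ Sum.inr)) := by
    ext x y
    have h4 : Matrix.single (x ∘ Sum.inl) (y ∘ Sum.inl) (1 : ℂ) =
        Matrix.of fun a b => Matrix.vecMulVec v (star v) (e (x ∘ Sum.inl), a)
          (e (y ∘ Sum.inl), b) := by
      ext a b
      simp only [hv, Matrix.vecMulVec_apply, Matrix.single_apply, Matrix.of_apply, Pi.star_apply,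
        EmbeddingLike.apply_eq_iff_eq, ite_and]
      split_ifs <;> simp
    simp only [choi, ampliate, Matrix.of_apply, Matrix.smul_apply, Matrix.submatrix_apply,
      smul_eq_mul, h4]
  rw [h3]
  refine h2.smul ?_
  have h5 : (0 : ℝ) ≤ (2 ^ n)⁻¹ := by positivity
  have h6 : ((2 ^ n : ℂ)⁻¹) = (((2 ^ n)⁻¹ : ℝ) : ℂ) := by push_cast; rfl
  rw [h6]
  exact_mod_cast h5

theorem choi_trace (hE : IsChannel E) : (choi E).trace = 1 := by
  simp only [Matrix.trace, Matrix.diag_apply, choi, Matrix.of_apply]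
  rw [← Finset.mul_sum, ← (Equiv.sumArrowEquivProdArrow (Fin n) (Fin n) (Fin 2)).symm.sum_comp,
    Fintype.sum_prod_type]
  have h : ∀ a : Bits (Fin n), ∑ b : Bits (Fin n), E (Matrix.single a a 1) b b = 1 := fun a => by
    have := hE.2 (Matrix.single a a 1)
    rw [Matrix.trace_single_eq_same] at this
    simpa [Matrix.trace] using this
  have h2 : ∀ a b : Bits (Fin n),
      ((Equiv.sumArrowEquivProdArrow (Fin n) (Fin n) (Fin 2)).symm (a, b)) ∘ Sum.inl = a ∧
      ((Equiv.sumArrowEquivProdArrow (Fin n) (Fin n) (Fin 2)).symm (a, b)) ∘ Sum.inr = b :=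
    fun a b => ⟨rfl, rfl⟩
  simp only [h2, h]
  simp

theorem choi_isDensity (hE : IsChannel E) : IsDensity (choi E) :=
  ⟨choi_posSemidef hE, choi_trace hE⟩

theorem card_bothSides (S : Finset (Fin n)) : (bothSides S).card = 2 * S.card := by
  rw [bothSides, Finset.card_disjSum, two_mul]

end Choi

section Reduced

variable {Q : Type} [Fintype Q] [DecidableEq Q]

/-- Splitting a bit string into its parts on `T` and off `T`. -/
def glueEquiv (T : Finset Q) : Bits T × Bits {q // q ∉ T} ≃ Bits Q where
  toFun p := glue T p.1 p.2
  invFun x := (fun q => x q, fun q => x q)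
  left_inv p := by
    ext q
    · simp [glue, q.2]
    · simp [glue, q.2]
  right_inv x := by
    ext q
    by_cases h : q ∈ T <;> simp [glue, h]

theorem pauliString_extendPauli_glue (T : Finset Q) (p : T → Fin 4) (a b : Bits T)
    (c d : Bits {q // q ∉ T}) :
    pauliString (extendPauli T p) (glue T a c) (glue T b d) =
      pauliString p a b * if c = d then 1 else 0 := by
  simp only [pauliString, Matrix.of_apply]
  rw [← Fintype.prod_subtype_mul_prod_subtype (fun q => q ∈ T)]
  congr 1
  · refine Finset.prod_congr (by ext; simp) fun q _ => ?_
    simp [extendPauli, glue, q.2]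
  · have : ∀ q : {q // q ∉ T}, pauli1 (extendPauli T p q) (glue T a c q) (glue T b d q) =
        if c q = d q then 1 else 0 := fun q => by
      simp [extendPauli, glue, q.2, pauli1, Matrix.one_apply]
    simp only [this]
    rw [prod_ite_all]
    simp [funext_iff]

/-- Partial trace is dual to tensoring with the identity, so local coefficients are global ones. -/
theorem trace_pauliString_mul_reduced (T : Finset Q) (ρ : Op Q) (p : T → Fin 4) :
    (pauliString p * reduced T ρ).trace = (pauliString (extendPauli T p) * ρ).trace := by
  simp only [Matrix.trace, Matrix.diag_apply, Matrix.mul_apply]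
  rw [← (glueEquiv T).sum_comp, Fintype.sum_prod_type]
  refine Finset.sum_congr rfl fun a _ => ?_
  have h : ∀ c, ∑ y, pauliString (extendPauli T p) (glueEquiv T (a, c)) y *
      ρ y (glueEquiv T (a, c)) =
      ∑ b, pauliString p a b * ρ (glue T b c) (glue T a c) := by
    intro c
    rw [← (glueEquiv T).sum_comp, Fintype.sum_prod_type]
    refine Finset.sum_congr rfl fun b _ => ?_
    simp only [glueEquiv, Equiv.coe_fn_mk, pauliString_extendPauli_glue]
    simp
  simp only [h]
  rw [Finset.sum_comm]
  refine Finset.sum_congr rfl fun b _ => ?_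
  rw [reduced, Matrix.of_apply, Finset.mul_sum]

theorem trace_mul_eq_ofReal {A B : Op Q} (hA : A.IsHermitian) (hB : B.IsHermitian) :
    (A * B).trace = ((A * B).trace.re : ℂ) := by
  have h : star (A * B).trace = (A * B).trace := by
    rw [← Matrix.trace_conjTranspose, Matrix.conjTranspose_mul, hA.eq, hB.eq,
      Matrix.trace_mul_comm]
  exact (Complex.conj_eq_iff_re.1 h).symm

/-- The Frobenius error of the estimate in terms of the errors of the Pauli coefficients. -/
theorem frobNorm_estimateReduced_sub_sq {Ω : Type*} [MeasurableSpace Ω]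
    (P : MeasurementPrimitive Q Ω) {N : ℕ} (K : ℕ) (ω : Fin N → Ω) (T : Finset Q) {ρ : Op Q}
    (hρ : ρ.IsHermitian) :
    frobNorm (estimateReduced P K ω T - reduced T ρ) ^ 2 =
      (2 ^ T.card)⁻¹ * ∑ p : T → Fin 4,
        (estimate P K ω (pauliString (extendPauli T p)) -
          (pauliString (extendPauli T p) * ρ).trace.re) ^ 2 := by
  have h : estimateReduced P K ω T - reduced T ρ = ∑ p : T → Fin 4,
      ((((2 ^ T.card)⁻¹ * (estimate P K ω (pauliString (extendPauli T p)) -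
          (pauliString (extendPauli T p) * ρ).trace.re) : ℝ)) : ℂ) • pauliString p := by
    rw [pauli_expansion (reduced T ρ), estimateReduced, Fintype.card_coe, ← smul_sub,
      ← Finset.sum_sub_distrib, Finset.smul_sum]
    refine Finset.sum_congr rfl fun p _ => ?_
    rw [trace_pauliString_mul_reduced, trace_mul_eq_ofReal (pauliString_isHermitian _) hρ,
      ← sub_smul, smul_smul]
    push_cast
    rfl
  rw [h, frobNorm_sq_sum_pauliString, Fintype.card_coe]
  simp only [mul_pow, ← Finset.mul_sum]
  rw [← mul_assoc]
  congr 1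
  field_simp

end Reduced

/-! ### From coefficient-wise tail bounds to the sample complexity -/

section Union

variable {n : ℕ} {Ω : Type*} [MeasurableSpace Ω]

/-- Union bound over `C(n,k) · 16^k ≤ (16n)^k` coefficients. The tolerance `t` may vary with the
string, which the trace-norm bound exploits. -/
theorem suffices_of_tail {P : MeasurementPrimitive (ChoiQubits n) Ω} (hP : P.IsPOVM)
    (nrm : ∀ {Q : Type} [Fintype Q] [DecidableEq Q], Op Q → ℝ) {k : ℕ} {ε δ : ℝ} {N : ℕ}
    (K : ℕ) (t : (ChoiQubits n → Fin 4) → ℝ) {η : ℝ} (hη : (16 * n) ^ k * η ≤ δ)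
    (hη0 : 0 ≤ η) (hδ : 0 ≤ δ)
    (htail : ∀ ρ : Op (ChoiQubits n), IsDensity ρ → ∀ S : Finset (Fin n), S.card = k →
      ∀ p : bothSides S → Fin 4,
        Measure.pi (fun _ : Fin N => P.law ρ)
          {ω | t (extendPauli _ p) < |estimate P K ω (pauliString (extendPauli _ p)) -
            (pauliString (extendPauli _ p) * ρ).trace.re|} ≤ ENNReal.ofReal η)
    (hnrm : ∀ ρ : Op (ChoiQubits n), IsDensity ρ → ∀ S : Finset (Fin n), S.card = k →
      ∀ ω : Fin N → Ω, (∀ p : bothSides S → Fin 4,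
        |estimate P K ω (pauliString (extendPauli _ p)) -
            (pauliString (extendPauli _ p) * ρ).trace.re| ≤ t (extendPauli _ p)) →
        nrm (estimateReduced P K ω (bothSides S) - reduced (bothSides S) ρ) ≤ ε) :
    Suffices P nrm k ε δ N := by
  refine ⟨K, fun E hE => ?_⟩
  have hρ := choi_isDensity hE
  have := MeasurementPrimitive.isProbabilityMeasure_law hP hρ
  set μ := Measure.pi (fun _ : Fin N => P.law (choi E))
  set G : Set (Fin N → Ω) := {ω | ∀ S : Finset (Fin n), S.card = k →
        nrm (estimateReduced P K ω (bothSides S) - reduced (bothSides S) (choi E)) ≤ ε}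
  set bad : ((S : Finset (Fin n)) × (bothSides S → Fin 4)) → Set (Fin N → Ω) := fun q =>
    {ω | t (extendPauli _ q.2) < |estimate P K ω (pauliString (extendPauli _ q.2)) -
            (pauliString (extendPauli _ q.2) * choi E).trace.re|}
  set I : Finset ((S : Finset (Fin n)) × (bothSides S → Fin 4)) :=
    (Finset.powersetCard k Finset.univ).sigma fun _ => Finset.univ
  have hI : I.card ≤ (16 * n) ^ k := by
    rw [Finset.card_sigma]
    have h1 : ∀ S ∈ Finset.powersetCard k (Finset.univ : Finset (Fin n)),
        (Finset.univ : Finset (bothSides S → Fin 4)).card = 16 ^ k := fun S hS => by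
      rw [Finset.card_univ, Fintype.card_fun, Fintype.card_fin, Fintype.card_coe, card_bothSides,
        (Finset.mem_powersetCard.1 hS).2, pow_mul]
      norm_num
    rw [Finset.sum_congr rfl h1, Finset.sum_const, Finset.card_powersetCard, Finset.card_univ,
      Fintype.card_fin, smul_eq_mul, mul_pow, mul_comm]
    exact Nat.mul_le_mul_left _ (Nat.choose_le_pow n k)
  have hsub : Gᶜ ⊆ ⋃ q ∈ I, bad q := by
    intro ω hω
    by_contra hcon
    refine hω fun S hS => hnrm _ hρ S hS ω fun p => ?_
    by_contra hlt
    refine hcon ?_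
    simp only [Set.mem_iUnion]
    exact ⟨⟨S, p⟩, Finset.mem_sigma.2 ⟨Finset.mem_powersetCard.2 ⟨Finset.subset_univ _, hS⟩,
      Finset.mem_univ _⟩, not_le.1 hlt⟩
  have hGc : μ Gᶜ ≤ ENNReal.ofReal δ := by
    refine (measure_mono hsub).trans ((measure_biUnion_finset_le _ _).trans ?_)
    refine (Finset.sum_le_card_nsmul I _ (ENNReal.ofReal η) fun q hq =>
      htail _ hρ q.1 (Finset.mem_powersetCard.1 (Finset.mem_sigma.1 hq).1).2 q.2).trans ?_
    rw [nsmul_eq_mul, ← ENNReal.ofReal_natCast, ← ENNReal.ofReal_mul (by positivity)]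
    refine ENNReal.ofReal_le_ofReal (le_trans ?_ hη)
    gcongr
    exact_mod_cast hI
  -- Subadditivity of the outer measure suffices here and avoids proving that `G` is measurable.
  have h1 : (1 : ENNReal) ≤ μ G + μ Gᶜ := by
    have h2 := measure_union_le (μ := μ) G Gᶜ
    rwa [Set.union_compl_self, measure_univ] at h2
  rw [ENNReal.ofReal_sub _ hδ, ENNReal.ofReal_one]
  exact tsub_le_iff_right.2 (h1.trans (by gcongr))

end Union

/-! ### Sample complexity of the Frobenius norm for general primitives -/

section General

open ProbabilityTheory MeasurementPrimitive

variable {n : ℕ} {Ω : Type*} [MeasurableSpace Ω] {P : MeasurementPrimitive (ChoiQubits n) Ω}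

theorem traceless_one {Q : Type} [Fintype Q] [DecidableEq Q] : traceless (1 : Op Q) = 0 := by
  rw [traceless, Matrix.trace_one]
  simp

theorem traceless_eq_self {Q : Type} [Fintype Q] [DecidableEq Q] {O : Op Q} (h : O.trace = 0) :
    traceless O = O := by
  simp [traceless, h]

theorem estimate_eq {Q : Type} [Fintype Q] [DecidableEq Q] {P : MeasurementPrimitive Q Ω}
    (hP : P.IsPOVM) (hT : P.TomographicallyComplete) {N : ℕ} (K : ℕ) (ω : Fin N → Ω) (O : Op Q) :
    estimate P K ω O = medianOfMeans K fun i => expect (P.state (ω i)) (P.invChannel O) := by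
  simp only [estimate, re_trace_mul_shadow hP hT]

theorem integral_law_eq_re_trace {Q : Type} [Fintype Q] [DecidableEq Q]
    {P : MeasurementPrimitive Q Ω} (hP : P.IsPOVM) (hT : P.TomographicallyComplete) {ρ : Op Q}
    (hρ : IsDensity ρ) (s : Q → Fin 4) :
    ∫ ω, expect (P.state ω) (P.invChannel (pauliString s)) ∂P.law ρ =
      (pauliString s * ρ).trace.re := by
  rw [← integral_law_invChannel hP hρ hT (pauliString_isHermitian s), Complex.ofReal_re]

/-- The identity string is estimated by the constant `1`, with no variance; all other strings are
traceless already, and their second moment bounds the variance. -/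
theorem variance_law_le {Q : Type} [Fintype Q] [DecidableEq Q]
    {P : MeasurementPrimitive Q Ω} (hP : P.IsPOVM) (hT : P.TomographicallyComplete) {ρ : Op Q}
    (hρ : IsDensity ρ) (s : Q → Fin 4) :
    Var[fun ω => expect (P.state ω) (P.invChannel (pauliString s)); P.law ρ] ≤
      P.shadowNorm (traceless (pauliString s)) ^ 2 := by
  have := isProbabilityMeasure_law hP hρ
  by_cases hs : s = 0
  · have h1 : P.invChannel (pauliString s) = 1 := hT.1 <| by
      rw [shadowChannel_invChannel hT, shadowChannel_one hP, hs, pauliString_zero]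
    simp only [h1, expect_one hP]
    rw [variance_eq_integral aemeasurable_const]
    simp only [integral_const, probReal_univ, smul_eq_mul, mul_one, sub_self]
    simpa using sq_nonneg _
  · rw [traceless_eq_self (pauliString_trace hs)]
    refine (variance_le_expectation_sq (hP.measurable_expect _).aestronglyMeasurable).trans ?_
    simp only [Pi.pow_apply]
    rw [integral_law hP hρ]
    exact integral_sq_le_shadowNorm_sq hP hρ _

theorem one_le_log_of_three_le {x : ℝ} (h : 3 ≤ x) : 1 ≤ Real.log x := by
  rw [Real.le_log_iff_exp_le (by linarith)]
  linarith [Real.exp_one_lt_three]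

theorem suffices_frobNorm (hP : P.IsPOVM) (hT : P.TomographicallyComplete) {k : ℕ} (hk : 1 ≤ k)
    (hn : 1 ≤ n) {ε δ : ℝ} (hε : 0 < ε) (hε1 : ε < 1) (hδ : 0 < δ) (hδ1 : δ < 1) {V : ℝ}
    (hV1 : 1 ≤ V)
    (hV : ∀ S : Finset (Fin n), S.card = k → ∀ p : bothSides S → Fin 4,
      P.shadowNorm (traceless (pauliString (extendPauli _ p))) ^ 2 ≤ V)
    {N : ℕ} (hN : 68 / ε ^ 2 * 4 ^ k * Real.log (2 * (8 * n) ^ (2 * k) / δ) * V ≤ N) :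
    Suffices P frobNorm k ε δ N := by
  have hnR : (1 : ℝ) ≤ n := by exact_mod_cast hn
  set L := Real.log (2 * (8 * n) ^ (2 * k) / δ) with hL
  have hpow : (8 : ℝ) ≤ (8 * n) ^ (2 * k) := by
    calc (8 : ℝ) ≤ 8 * n := by linarith
      _ ≤ (8 * n) ^ (2 * k) := le_self_pow₀ (by linarith) (by omega)
  have hL1 : 1 ≤ L := by
    refine one_le_log_of_three_le ?_
    rw [le_div_iff₀ hδ]
    nlinarith
  -- Then `K + 1 > L` gives failure probability below `e^(-L)`, while `K + 1 ≤ L + 1 ≤ 2L` keeps the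
  -- batches large.
  set K := ⌊L⌋₊ with hK
  have hKL : (K : ℝ) ≤ L := Nat.floor_le (by linarith)
  have hLK : L < K + 1 := Nat.lt_floor_add_one L
  set s : ℝ := 4 ^ k / ε ^ 2 * V with hs
  have hs1 : 1 ≤ s := by
    have h4 : (1 : ℝ) ≤ 4 ^ k := one_le_pow₀ (by norm_num)
    have h5 : (1 : ℝ) ≤ 4 ^ k / ε ^ 2 := by
      rw [le_div_iff₀ (by positivity)]
      nlinarith
    rw [hs]
    nlinarith
  have hNs : 68 * s * L ≤ N := by
    refine le_trans (le_of_eq ?_) hN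
    rw [hs]; ring
  set b := N / (K + 1) with hb
  -- Otherwise `b + 1 ≤ 34 s`, using `s ≥ 1` to absorb the rounding, and then `N < 34 s (L + 1) ≤ 68
  -- s L`. This is the origin of the constant 68; the tail bound itself needs only 32.
  have hbs : 33 * s < b := by
    have h1 : N < (b + 1) * (K + 1) := by
      rw [hb, mul_comm]
      exact Nat.lt_mul_div_succ N (Nat.succ_pos K)
    have h2 : (N : ℝ) < (b + 1) * (K + 1) := by exact_mod_cast h1
    have h3 : ((b : ℝ) + 1) * (K + 1) ≤ (b + 1) * (L + 1) := by gcongr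
    by_contra hcon
    have h4 : (b : ℝ) + 1 ≤ 34 * s := by linarith
    have h5 : ((b : ℝ) + 1) * (L + 1) ≤ 34 * s * (L + 1) := by gcongr
    nlinarith
  have hb0 : 0 < b := by
    have : (0 : ℝ) < b := by linarith
    exact_mod_cast this
  have ht : 0 < ε / 2 ^ k := by positivity
  have ht2 : (ε / 2 ^ k) ^ 2 = ε ^ 2 / 4 ^ k := by
    rw [div_pow, ← pow_mul, mul_comm k 2, pow_mul]; norm_num
  have hbV : 32 * V ≤ b * (ε / 2 ^ k) ^ 2 := by
    have h1 : V = s * (ε / 2 ^ k) ^ 2 := by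
      rw [ht2, hs]
      field_simp
    rw [h1, ← mul_assoc]
    gcongr
    linarith
  refine suffices_of_tail hP _ K (fun _ => ε / 2 ^ k) (η := Real.exp (-(K + 1))) ?_ (Real.exp_pos _).le hδ.le
    ?_ ?_
  · have h1 : Real.exp (-(K + 1)) ≤ δ / (2 * (8 * n) ^ (2 * k)) := by
      refine (Real.exp_le_exp.2 (show -((K : ℝ) + 1) ≤ -L by linarith)).trans ?_
      rw [Real.exp_neg, Real.exp_log (by positivity), inv_div]
    have h2 : ((16 : ℝ) * n) ^ k ≤ 2 * (8 * n) ^ (2 * k) := by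
      have : ((16 : ℝ) * n) ^ k ≤ ((8 * n) ^ 2) ^ k := by
        refine pow_le_pow_left₀ (by positivity) ?_ k
        nlinarith
      rw [← pow_mul] at this
      have h3 : (0 : ℝ) ≤ (8 * n) ^ (2 * k) := by positivity
      linarith
    calc ((16 : ℝ) * n) ^ k * Real.exp (-(K + 1))
        ≤ (2 * (8 * n) ^ (2 * k)) * (δ / (2 * (8 * n) ^ (2 * k))) := by gcongr
      _ = δ := by field_simp
  · intro ρ hρ S hS p
    have := isProbabilityMeasure_law hP hρ
    simp only [estimate_eq hP hT, ← integral_law_eq_re_trace hP hT hρ]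
    exact medianOfMeans_tail (X := fun ω => expect (P.state ω)
      (P.invChannel (pauliString (extendPauli (bothSides S) p)))) (hP.measurable_expect _)
      (hP.abs_expect_le _) ((variance_law_le hP hT hρ _).trans (hV S hS p)) ht hb0 hbV
  · intro ρ hρ S hS ω hω
    refine (sq_le_sq₀ (frobNorm_nonneg _) hε.le).1 ?_
    rw [frobNorm_estimateReduced_sub_sq _ _ _ _ hρ.1.isHermitian, card_bothSides, hS]
    have h1 : ∑ p : bothSides S → Fin 4, (estimate P K ω (pauliString (extendPauli _ p)) -
          (pauliString (extendPauli _ p) * ρ).trace.re) ^ 2 ≤ 16 ^ k * (ε ^ 2 / 4 ^ k) := by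
      refine (Finset.sum_le_card_nsmul _ _ (ε ^ 2 / 4 ^ k) fun p _ => ?_).trans (le_of_eq ?_)
      · rw [← ht2, ← sq_abs]
        exact pow_le_pow_left₀ (abs_nonneg _) (hω p) 2
      · rw [Finset.card_univ, Fintype.card_fun, Fintype.card_fin, Fintype.card_coe, card_bothSides,
          hS, pow_mul, nsmul_eq_mul]
        norm_num
    have h2 : (2 : ℝ) ^ (2 * k) = 4 ^ k := by rw [pow_mul]; norm_num
    have h3 : (16 : ℝ) ^ k = 4 ^ k * 4 ^ k := by rw [← mul_pow]; norm_num
    rw [h2]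
    calc ((4 : ℝ) ^ k)⁻¹ * _ ≤ (4 ^ k)⁻¹ * (16 ^ k * (ε ^ 2 / 4 ^ k)) := by gcongr
      _ = ε ^ 2 := by rw [h3]; field_simp

theorem shadowNorm_sq_le_maxShadowNormSq {k : ℕ} {S : Finset (Fin n)} (hS : S.card = k)
    (p : bothSides S → Fin 4) :
    P.shadowNorm (traceless (pauliString (extendPauli _ p))) ^ 2 ≤ maxShadowNormSq k P :=
  le_ciSup (f := fun p : (S : {S : Finset (Fin n) // S.card = k}) × (bothSides S.1 → Fin 4) =>
    P.shadowNorm (traceless (pauliString (extendPauli (bothSides p.1.1) p.2))) ^ 2)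
    (Set.finite_range _).bddAbove ⟨⟨S, hS⟩, p⟩

theorem one_le_maxShadowNormSq (hP : P.IsPOVM) (hT : P.TomographicallyComplete) {k : ℕ}
    (hk : 1 ≤ k) (hkn : k ≤ n) : 1 ≤ maxShadowNormSq k P := by
  obtain ⟨S, -, hS⟩ := Finset.exists_subset_card_eq
    (s := (Finset.univ : Finset (Fin n))) (n := k) (by simpa using hkn)
  -- The witness is `X` on every input and output qubit of `S`, a nonidentity string because `k ≥
  -- 1`.
  refine le_trans ?_ (shadowNorm_sq_le_maxShadowNormSq hS fun _ => 1)
  have hne : extendPauli (bothSides S) (fun _ => 1) ≠ 0 := by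
    obtain ⟨i, hi⟩ := Finset.card_pos.1 (hS ▸ hk)
    intro h
    have h1 := congrFun h (Sum.inl i)
    have h2 : Sum.inl i ∈ bothSides S := Finset.inl_mem_disjSum.2 hi
    simp [extendPauli, h2] at h1
  rw [traceless_eq_self (pauliString_trace hne)]
  exact one_le_shadowNorm_sq hP hT (pauliString_isHermitian _) (pauliString_mul_self _)

end General

/-! ### Primitives whose measurement channel is diagonal in the Pauli basis -/

/-- The measurement channel multiplies every Pauli string `s` by `c s > 0`, and the second moment
of the outcomes of every Pauli string is `c s` in every state. -/
structure IsPauliDiagonal {Q : Type} [Fintype Q] [DecidableEq Q] {Ω : Type*} [MeasurableSpace Ω]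
    (P : MeasurementPrimitive Q Ω) (c : (Q → Fin 4) → ℝ) : Prop where
  pos : ∀ s, 0 < c s
  first : ∀ s x y, ∫ ω, P.ev (pauliString s) ω * ketbra (P.state ω) x y ∂P.weight =
    c s * pauliString s x y
  second : ∀ s x y, ∫ ω, P.ev (pauliString s) ω ^ 2 * ketbra (P.state ω) x y ∂P.weight =
    c s * (1 : Op Q) x y

namespace IsPauliDiagonal

open MeasurementPrimitive

variable {Q : Type} [Fintype Q] [DecidableEq Q] {Ω : Type*} [MeasurableSpace Ω]
  {P : MeasurementPrimitive Q Ω} {c : (Q → Fin 4) → ℝ} (hc : IsPauliDiagonal P c) (hP : P.IsPOVM)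
include hc

theorem shadowChannel_pauliString (s : Q → Fin 4) :
    P.shadowChannel (pauliString s) = (c s : ℂ) • pauliString s := by
  ext x y
  exact hc.first s x y

include hP

theorem tomographicallyComplete : P.TomographicallyComplete := by
  have hsurj : Function.Surjective hP.shadowChannelLin := by
    intro A
    refine ⟨(2 ^ Fintype.card Q : ℂ)⁻¹ •
      ∑ s, ((pauliString s * A).trace * (c s : ℂ)⁻¹) • pauliString s, ?_⟩
    conv_rhs => rw [pauli_expansion A]
    rw [map_smul, map_sum]
    congr 1
    refine Finset.sum_congr rfl fun s _ => ?_
    have h0 : (c s : ℂ) ≠ 0 := by exact_mod_cast (hc.pos s).ne'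
    have h1 : hP.shadowChannelLin (pauliString s) = (c s : ℂ) • pauliString s :=
      hc.shadowChannel_pauliString s
    rw [map_smul, h1, smul_smul, inv_mul_cancel_right₀ h0]
  exact ⟨LinearMap.injective_iff_surjective.2 hsurj, hsurj⟩

theorem invChannel_pauliString (s : Q → Fin 4) :
    P.invChannel (pauliString s) = (c s : ℂ)⁻¹ • pauliString s := by
  have hT := hc.tomographicallyComplete hP
  refine hT.1 ?_
  have h0 : (c s : ℂ) ≠ 0 := by exact_mod_cast (hc.pos s).ne'
  rw [shadowChannel_invChannel hT, shadowChannel_smul, hc.shadowChannel_pauliString, smul_smul,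
    inv_mul_cancel₀ h0, one_smul]

theorem expect_invChannel (s : Q → Fin 4) (ω : Ω) :
    expect (P.state ω) (P.invChannel (pauliString s)) =
      (c s)⁻¹ * expect (P.state ω) (pauliString s) := by
  rw [hc.invChannel_pauliString hP, expect_eq_re_ev, ev_smul, expect_eq_re_ev,
    ← Complex.ofReal_inv, Complex.re_ofReal_mul]

theorem abs_expect_invChannel_le (s : Q → Fin 4) (ω : Ω) :
    |expect (P.state ω) (P.invChannel (pauliString s))| ≤ (c s)⁻¹ := by
  rw [hc.expect_invChannel hP, abs_mul, abs_of_pos (inv_pos.2 (hc.pos s))]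
  exact mul_le_of_le_one_right (inv_pos.2 (hc.pos s)).le (abs_expect_le_one_of_involution hP
    (pauliString_isHermitian s) (pauliString_mul_self s) ω)

/-- The squared outcomes average to a multiple of the identity, so pairing with `σ` sees only its
trace. Dividing by `c s` twice then gives the second moment `1 / c s` for the estimator. -/
theorem integral_expect_mul_sq {σ : Op Q} (hσ : IsDensity σ) (s : Q → Fin 4) :
    ∫ ω, expect (P.state ω) σ * expect (P.state ω) (pauliString s) ^ 2 ∂P.weight = c s := by
  have hi : ∀ x y, Integrable
      (fun ω => P.ev (pauliString s) ω ^ 2 * (σ x y * ketbra (P.state ω) y x)) P.weight :=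
    fun x y => by
      simp only [pow_two, mul_assoc]
      exact hP.integrable_ev_mul (hP.integrable_ev_mul
        ((hP.integrable_ketbra y x).const_mul _) _) _
  have h1 : ∫ ω, P.ev (pauliString s) ω ^ 2 * P.ev σ ω ∂P.weight = (c s : ℂ) := by
    simp only [ev_eq_sum σ, Finset.mul_sum]
    rw [integral_finsetSum _ fun x _ => integrable_finsetSum _ fun y _ => hi x y]
    have h2 : ∀ x, ∫ ω, ∑ y, P.ev (pauliString s) ω ^ 2 * (σ x y * ketbra (P.state ω) y x)
        ∂P.weight = c s * σ x x := by
      intro x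
      rw [integral_finsetSum _ fun y _ => hi x y]
      have h3 : ∀ y, ∫ ω, P.ev (pauliString s) ω ^ 2 * (σ x y * ketbra (P.state ω) y x)
          ∂P.weight = σ x y * (c s * (1 : Op Q) y x) := by
        intro y
        rw [← hc.second, ← integral_const_mul]
        exact integral_congr_ae (ae_of_all _ fun ω => by ring)
      simp only [h3, Matrix.one_apply]
      simp [mul_comm]
    simp only [h2]
    rw [← Finset.mul_sum]
    have := hσ.2
    simp only [Matrix.trace, Matrix.diag_apply] at this
    rw [this, mul_one]
  simp only [ev_eq_ofReal hσ.1.isHermitian, ev_eq_ofReal (pauliString_isHermitian s),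
    ← Complex.ofReal_pow, ← Complex.ofReal_mul, integral_complex_ofReal] at h1
  have h4 := Complex.ofReal_injective h1
  rw [← h4]
  exact integral_congr_ae (ae_of_all _ fun ω => mul_comm _ _)

theorem integral_expect_mul_invChannel_sq {σ : Op Q} (hσ : IsDensity σ) (s : Q → Fin 4) :
    ∫ ω, expect (P.state ω) σ * expect (P.state ω) (P.invChannel (pauliString s)) ^ 2 ∂P.weight =
      (c s)⁻¹ := by
  have h := hc.integral_expect_mul_sq hP hσ s
  have h1 : ∀ ω, expect (P.state ω) σ * expect (P.state ω) (P.invChannel (pauliString s)) ^ 2 =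
      (c s)⁻¹ ^ 2 * (expect (P.state ω) σ * expect (P.state ω) (pauliString s) ^ 2) := fun ω => by
    rw [hc.expect_invChannel hP]; ring
  simp only [h1]
  rw [integral_const_mul, h]
  have := hc.pos s
  field_simp

theorem shadowNorm_traceless_sq_le {V : ℝ} (hV : 0 ≤ V) {s : Q → Fin 4} (h : (c s)⁻¹ ≤ V) :
    P.shadowNorm (traceless (pauliString s)) ^ 2 ≤ V := by
  by_cases hs : s = 0
  · rw [hs, pauliString_zero, traceless_one]
    exact (shadowNorm_zero_sq hP (hc.tomographicallyComplete hP)).trans hV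
  · rw [traceless_eq_self (pauliString_trace hs)]
    exact shadowNorm_sq_le hV fun σ hσ =>
      (hc.integral_expect_mul_invChannel_sq hP hσ s).trans_le h

/-- The range bound and the second moment are both `1 / c s`, so the smallness condition of
`mean_tail` reduces to `t ≤ 3/10`. -/
theorem empirical_mean_tail {ρ : Op Q} (hρ : IsDensity ρ) (s : Q → Fin 4) {t : ℝ} (ht : 0 < t)
    (ht1 : t ≤ 3 / 10) {N : ℕ} (hN : 0 < N) :
    Measure.pi (fun _ : Fin N => P.law ρ)
      {ω | t < |estimate P 0 ω (pauliString s) - (pauliString s * ρ).trace.re|} ≤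
        ENNReal.ofReal (2 * Real.exp (-(N * t ^ 2 / (12 / 5 * (c s)⁻¹)))) := by
  have hT := hc.tomographicallyComplete hP
  have := isProbabilityMeasure_law hP hρ
  have hc0 := inv_pos.2 (hc.pos s)
  simp only [estimate_eq hP hT, ← integral_law_eq_re_trace hP hT hρ, medianOfMeans_zero]
  refine mean_tail (X := fun ω => expect (P.state ω) (P.invChannel (pauliString s)))
    (hP.measurable_expect _) (hc.abs_expect_invChannel_le hP s) ?_ hc0 ht ?_ hN
  · rw [integral_law hP hρ, hc.integral_expect_mul_invChannel_sq hP hρ]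
  · gcongr

end IsPauliDiagonal

/-! ### The Pauli-6 measurement -/

section Pauli6

open MeasurementPrimitive

/-- The Pauli matrix whose eigenvectors form the measurement basis `b`. -/
def pauli6Label : Fin 3 → Fin 4 := ![3, 1, 2]

/-- The eigenvalue of the `s`-th vector of a measurement basis. -/
def pauli6Sign : Fin 2 → ℂ := ![1, -1]

/-- Each projector is `(I ± σ)/2`, which reduces all later single-qubit sums to Pauli arithmetic. -/
theorem pauli6State_ketbra (o : Fin 3 × Fin 2) (i j : Fin 2) :
    pauli6State o i * star (pauli6State o j) =
      1 / 2 * ((1 : Matrix (Fin 2) (Fin 2) ℂ) i j +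
        pauli6Sign o.2 * pauli1 (pauli6Label o.1) i j) := by
  have hr : (Real.sqrt 2 : ℂ)⁻¹ * (Real.sqrt 2 : ℂ)⁻¹ = 1 / 2 := by
    rw [← mul_inv, ← Complex.ofReal_mul, Real.mul_self_sqrt (by norm_num)]
    norm_num
  have hs : (starRingEnd ℂ) (Real.sqrt 2 : ℂ)⁻¹ = (Real.sqrt 2 : ℂ)⁻¹ := by
    rw [map_inv₀, Complex.conj_ofReal]
  obtain ⟨b, s⟩ := o
  unfold pauli6State
  generalize (Real.sqrt 2 : ℂ)⁻¹ = r at hr hs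
  fin_cases b <;> fin_cases s <;> fin_cases i <;> fin_cases j <;>
    simp [pauli6Sign, pauli6Label, pauli1, one_add_one_eq_two, hs, -map_inv₀]
  all_goals
    first
      | linear_combination hr
      | linear_combination Complex.I * hr
      | linear_combination hr - r * r * Complex.I_sq

/-- The expectation of a Pauli matrix in a state of the Pauli-6 POVM. -/
def pauli6Ev (a : Fin 4) (o : Fin 3 × Fin 2) : ℂ :=
  ∑ i, ∑ j, pauli1 a i j * (pauli6State o j * star (pauli6State o i))

theorem pauli6Ev_eq (a : Fin 4) (o : Fin 3 × Fin 2) :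
    pauli6Ev a o = if a = 0 then 1 else if a = pauli6Label o.1 then pauli6Sign o.2 else 0 := by
  simp only [pauli6Ev, pauli6State_ketbra]
  obtain ⟨b, s⟩ := o
  fin_cases a <;> fin_cases b <;> fin_cases s <;>
    simp [pauli6Sign, pauli6Label, pauli1, Fin.sum_univ_two] <;> norm_num <;> ring_nf <;> simp

/-- The eigenvalue of the single-qubit Pauli-6 measurement channel at a Pauli matrix. -/
def pauli6Weight (a : Fin 4) : ℝ := if a = 0 then 1 else 1 / 3

theorem sum_pauli6State_ketbra (i j : Fin 2) :
    ∑ o, pauli6State o i * star (pauli6State o j) = 3 * (1 : Matrix (Fin 2) (Fin 2) ℂ) i j := by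
  simp only [pauli6State_ketbra]
  fin_cases i <;> fin_cases j <;>
    simp [Fintype.sum_prod_type, Fin.sum_univ_three, pauli6Sign, pauli6Label, pauli1] <;> norm_num

/-- For nonidentity `σ` only its own eigenbasis, one basis out of three, has nonzero expectations,
namely `±1`. Weighting its two projectors by the sign gives `σ`; weighting by the square gives `I`.
Hence the weight `1/3` in both moments. -/
theorem sum_pauli6Ev_mul (a : Fin 4) (i j : Fin 2) :
    ∑ o, pauli6Ev a o * (pauli6State o i * star (pauli6State o j)) =
      3 * (pauli6Weight a * pauli1 a i j) := by
  simp only [pauli6State_ketbra, pauli6Ev_eq]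
  fin_cases a <;> fin_cases i <;> fin_cases j <;>
    simp [Fintype.sum_prod_type, Fin.sum_univ_three, pauli6Sign, pauli6Label, pauli1,
      pauli6Weight] <;> norm_num <;> ring

theorem sum_pauli6Ev_sq_mul (a : Fin 4) (i j : Fin 2) :
    ∑ o, pauli6Ev a o ^ 2 * (pauli6State o i * star (pauli6State o j)) =
      3 * (pauli6Weight a * (1 : Matrix (Fin 2) (Fin 2) ℂ) i j) := by
  simp only [pauli6State_ketbra, pauli6Ev_eq]
  fin_cases a <;> fin_cases i <;> fin_cases j <;>
    simp [Fintype.sum_prod_type, Fin.sum_univ_three, pauli6Sign, pauli6Label, pauli1,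
      pauli6Weight] <;> norm_num

theorem sum_pauli6State_norm_sq (o : Fin 3 × Fin 2) : ∑ i, ‖pauli6State o i‖ ^ 2 = 1 := by
  have h : ((∑ i, ‖pauli6State o i‖ ^ 2 : ℝ) : ℂ) = 1 := by
    push_cast
    simp only [← Complex.mul_conj']
    have := fun i => pauli6State_ketbra o i i
    simp only [starRingEnd_apply, this]
    obtain ⟨b, s⟩ := o
    fin_cases b <;> simp [pauli6Label, pauli1, Fin.sum_univ_two] <;> ring
  exact_mod_cast h

variable {Q : Type} [Fintype Q] [DecidableEq Q]

theorem sum_prod_eq {ι κ R : Type*} [Fintype ι] [DecidableEq ι] [Fintype κ] [CommSemiring R]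
    (f : ι → κ → R) : ∑ x : ι → κ, ∏ i, f i (x i) = ∏ i, ∑ j, f i j := by
  rw [Finset.prod_univ_sum, Fintype.piFinset_univ]

omit [DecidableEq Q] in
theorem one_apply_eq_prod (x y : Bits Q) :
    (1 : Op Q) x y = ∏ q, (1 : Matrix (Fin 2) (Fin 2) ℂ) (x q) (y q) := by
  simp only [Matrix.one_apply]
  rw [prod_ite_all]
  simp [funext_iff]

theorem pauli6_ketbra (ω : Q → Fin 3 × Fin 2) (x y : Bits Q) :
    ketbra ((pauli6Measurement Q).state ω) x y =
      ∏ q, pauli6State (ω q) (x q) * star (pauli6State (ω q) (y q)) := by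
  simp [ketbra, Matrix.vecMulVec_apply, pauli6Measurement, Finset.prod_mul_distrib]

theorem pauli6_ev (s : Q → Fin 4) (ω : Q → Fin 3 × Fin 2) :
    (pauli6Measurement Q).ev (pauliString s) ω = ∏ q, pauli6Ev (s q) (ω q) := by
  rw [ev_eq_sum]
  simp only [pauli6_ketbra, pauliString, Matrix.of_apply, ← Finset.prod_mul_distrib]
  simp only [pauli6Ev]
  rw [← sum_prod_eq]
  refine Finset.sum_congr rfl fun x _ => ?_
  rw [← sum_prod_eq]

theorem pauli6_integral (f : (Q → Fin 3 × Fin 2) → ℂ) :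
    ∫ ω, f ω ∂(pauli6Measurement Q).weight = (3 ^ Fintype.card Q)⁻¹ * ∑ ω, f ω := by
  rw [pauli6Measurement, integral_smul_measure, integral_count]
  simp

omit [DecidableEq Q] in
theorem inv_mul_prod_three (f : Q → ℂ) :
    (3 ^ Fintype.card Q : ℂ)⁻¹ * ∏ q, 3 * f q = ∏ q, f q := by
  rw [Finset.prod_mul_distrib, Finset.prod_const, Finset.card_univ, inv_mul_cancel_left₀]
  positivity

theorem pauli6_isPOVM : (pauli6Measurement Q).IsPOVM := by
  refine ⟨?_, ?_, ?_, ?_⟩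
  · have : IsFiniteMeasure (Measure.count : Measure (Q → Fin 3 × Fin 2)) := inferInstance
    exact Measure.smul_finite _ (by simp)
  · exact measurable_of_finite _
  · intro ω
    simp only [pauli6Measurement, norm_prod, ← Finset.prod_pow]
    rw [sum_prod_eq fun q i => ‖pauli6State (ω q) i‖ ^ 2]
    simp only [sum_pauli6State_norm_sq, Finset.prod_const_one]
  · intro x y
    rw [pauli6_integral]
    simp only [pauli6_ketbra]
    rw [sum_prod_eq fun q o => pauli6State o (x q) * star (pauli6State o (y q))]
    simp only [sum_pauli6State_ketbra]
    rw [inv_mul_prod_three, one_apply_eq_prod]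

theorem pauli6_isPauliDiagonal :
    IsPauliDiagonal (pauli6Measurement Q) fun s => ∏ q, pauli6Weight (s q) where
  pos s := Finset.prod_pos fun q _ => by unfold pauli6Weight; split_ifs <;> norm_num
  first s x y := by
    rw [pauli6_integral]
    simp only [pauli6_ketbra, pauli6_ev, ← Finset.prod_mul_distrib]
    rw [sum_prod_eq fun q o => pauli6Ev (s q) o *
      (pauli6State o (x q) * star (pauli6State o (y q)))]
    simp only [sum_pauli6Ev_mul]
    rw [inv_mul_prod_three, Finset.prod_mul_distrib]
    simp [pauliString]
  second s x y := by
    rw [pauli6_integral]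
    simp only [pauli6_ketbra, pauli6_ev, ← Finset.prod_pow, ← Finset.prod_mul_distrib]
    rw [sum_prod_eq fun q o => pauli6Ev (s q) o ^ 2 *
      (pauli6State o (x q) * star (pauli6State o (y q)))]
    simp only [sum_pauli6Ev_sq_mul]
    rw [inv_mul_prod_three, Finset.prod_mul_distrib, one_apply_eq_prod]
    simp

theorem prod_pauli6Weight_extendPauli (T : Finset Q) (p : T → Fin 4) :
    (∏ q, pauli6Weight (extendPauli T p q))⁻¹ = ∏ q, (pauli6Weight (p q))⁻¹ := by
  rw [← Fintype.prod_subtype_mul_prod_subtype (fun q => q ∈ T), mul_inv, ← Finset.prod_inv_distrib]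
  have h1 : ∏ q : {q // q ∉ T}, pauli6Weight (extendPauli T p q) = 1 :=
    Finset.prod_eq_one fun q _ => by simp [extendPauli, q.2, pauli6Weight]
  rw [h1, inv_one, mul_one]
  refine Finset.prod_congr (by ext; simp) fun q _ => ?_
  simp [extendPauli, q.2]

theorem inv_pauli6Weight_le (a : Fin 4) : (pauli6Weight a)⁻¹ ≤ 3 := by
  unfold pauli6Weight; split_ifs <;> norm_num

theorem inv_pauli6Weight_pos (a : Fin 4) : 0 < (pauli6Weight a)⁻¹ := by
  unfold pauli6Weight; split_ifs <;> norm_num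

theorem inv_prod_pauli6Weight_le (T : Finset Q) (p : T → Fin 4) :
    (∏ q, pauli6Weight (extendPauli T p q))⁻¹ ≤ 3 ^ T.card := by
  rw [prod_pauli6Weight_extendPauli]
  refine (Finset.prod_le_prod (fun q _ => (inv_pauli6Weight_pos _).le)
    fun q _ => inv_pauli6Weight_le _).trans ?_
  simp

/-- The sum factorizes, each qubit contributing `1 + 3 + 3 + 3`. -/
theorem sum_inv_prod_pauli6Weight (T : Finset Q) :
    ∑ p : T → Fin 4, (∏ q, pauli6Weight (extendPauli T p q))⁻¹ = 10 ^ T.card := by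
  simp only [prod_pauli6Weight_extendPauli]
  rw [sum_prod_eq fun (_ : T) a => (pauli6Weight a)⁻¹]
  have : ∑ a, (pauli6Weight a)⁻¹ = 10 := by
    simp [Fin.sum_univ_four, pauli6Weight]; norm_num
  simp [this]

variable {n k : ℕ} {ε δ : ℝ} {N : ℕ}

theorem pauli6_suffices_frobNorm (hk : 1 ≤ k) (hn : 1 ≤ n) (hε : 0 < ε) (hε1 : ε < 1)
    (hδ : 0 < δ) (hδ1 : δ < 1)
    (hN : 68 / ε ^ 2 * 36 ^ k * Real.log (2 * (8 * n) ^ (2 * k) / δ) ≤ N) :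
    Suffices (pauli6Measurement (ChoiQubits n)) frobNorm k ε δ N := by
  have hP := pauli6_isPOVM (Q := ChoiQubits n)
  have hc := pauli6_isPauliDiagonal (Q := ChoiQubits n)
  refine suffices_frobNorm hP (hc.tomographicallyComplete hP) hk hn hε hε1 hδ hδ1
    (V := 9 ^ k) (one_le_pow₀ (by norm_num)) (fun S hS p => ?_) (le_trans (le_of_eq ?_) hN)
  · refine hc.shadowNorm_traceless_sq_le hP (by positivity)
      ((inv_prod_pauli6Weight_le _ p).trans ?_)
    rw [card_bothSides, hS, pow_mul]
    norm_num
  · have : (36 : ℝ) ^ k = 4 ^ k * 9 ^ k := by rw [← mul_pow]; norm_num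
    rw [this]; ring

theorem pauli6_suffices_traceNorm (hk : 1 ≤ k) (hn : 1 ≤ n) (hε : 0 < ε) (hε1 : ε < 1)
    (hδ : 0 < δ) (hδ1 : δ < 1)
    (hN : 8 / 3 * (144 ^ k / ε ^ 2) * Real.log ((24 * n) ^ (2 * k) / δ) ≤ N) :
    Suffices (pauli6Measurement (ChoiQubits n)) traceNorm k ε δ N := by
  have hP := pauli6_isPOVM (Q := ChoiQubits n)
  have hc := pauli6_isPauliDiagonal (Q := ChoiQubits n)
  have hnR : (1 : ℝ) ≤ n := by exact_mod_cast hn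
  set L := Real.log ((24 * n) ^ (2 * k) / δ) with hL
  have hpow : (24 : ℝ) ≤ (24 * n) ^ (2 * k) := by
    calc (24 : ℝ) ≤ 24 * n := by linarith
      _ ≤ (24 * n) ^ (2 * k) := le_self_pow₀ (by linarith) (by omega)
  have hL1 : 1 ≤ L := by
    refine one_le_log_of_three_le ?_
    rw [le_div_iff₀ hδ]
    nlinarith
  have hN0 : 0 < N := by
    have : (0 : ℝ) < N := lt_of_lt_of_le (by positivity) hN
    exact_mod_cast this
  set c : (ChoiQubits n → Fin 4) → ℝ := fun s => ∏ q, pauli6Weight (s q)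
  have hcpos : ∀ s, 0 < (c s)⁻¹ := fun s => inv_pos.2 (hc.pos s)
  -- One batch, i.e. the plain mean. Tolerances proportional to `√(1 / c s)` make all tail exponents
  -- equal, and their squares sum to `ε²`.
  refine suffices_of_tail hP _ 0 (fun s => ε * Real.sqrt (c s)⁻¹ / 10 ^ k)
    (η := 2 * Real.exp (-L)) ?_ (by positivity) hδ.le ?_ ?_
  · rw [Real.exp_neg, Real.exp_log (by positivity), inv_div]
    -- The factor 2 from the two-sided tail is absorbed through `2 ≤ 2^k`.
    have h2 : ((16 : ℝ) * n) ^ k * 2 ≤ (24 * n) ^ (2 * k) := by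
      have h3 : ((16 : ℝ) * n * 2) ^ k ≤ ((24 * n) ^ 2) ^ k := by
        refine pow_le_pow_left₀ (by positivity) ?_ k
        nlinarith
      rw [← pow_mul, mul_pow (16 * (n : ℝ)) 2] at h3
      have h4 : (2 : ℝ) ≤ 2 ^ k := le_self_pow₀ (by norm_num) (by omega)
      exact (mul_le_mul_of_nonneg_left h4 (by positivity)).trans h3
    calc ((16 : ℝ) * n) ^ k * (2 * (δ / (24 * n) ^ (2 * k)))
        = (16 * n) ^ k * 2 * (δ / (24 * n) ^ (2 * k)) := by ring
      _ ≤ (24 * n) ^ (2 * k) * (δ / (24 * n) ^ (2 * k)) := by gcongr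
      _ = δ := by field_simp
  · intro ρ hρ S hS p
    set s := extendPauli (bothSides S) p
    have hv : (c s)⁻¹ ≤ 9 ^ k := by
      refine (inv_prod_pauli6Weight_le _ p).trans ?_
      rw [card_bothSides, hS, pow_mul]
      norm_num
    have hsv : Real.sqrt (c s)⁻¹ ≤ 3 ^ k := by
      rw [Real.sqrt_le_left (by positivity), ← pow_mul, mul_comm, pow_mul]
      norm_num
      exact hv
    have hsv0 : 0 < Real.sqrt (c s)⁻¹ := Real.sqrt_pos.2 (hcpos s)
    refine (hc.empirical_mean_tail hP hρ s (t := ε * Real.sqrt (c s)⁻¹ / 10 ^ k) (by positivity)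
      ?_ hN0).trans (ENNReal.ofReal_le_ofReal ?_)
    · have h1 : ((3 : ℝ) / 10) ^ k ≤ 3 / 10 := pow_le_of_le_one (by norm_num) (by norm_num)
        (by omega)
      calc ε * Real.sqrt (c s)⁻¹ / 10 ^ k ≤ 1 * 3 ^ k / 10 ^ k := by gcongr
        _ = (3 / 10) ^ k := by rw [one_mul, div_pow]
        _ ≤ 3 / 10 := h1
    · gcongr
      have h1 : (ε * Real.sqrt (c s)⁻¹ / 10 ^ k) ^ 2 = ε ^ 2 * (c s)⁻¹ / 100 ^ k := by
        rw [div_pow, mul_pow, Real.sq_sqrt (hcpos s).le, ← pow_mul, mul_comm k 2, pow_mul]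
        norm_num
      rw [h1]
      have h2 : (N : ℝ) * (ε ^ 2 * (c s)⁻¹ / 100 ^ k) / (12 / 5 * (c s)⁻¹) =
          N * (5 / 12 * (ε ^ 2 / 100 ^ k)) := by
        have : 0 < c s := hc.pos s
        field_simp
      rw [h2]
      -- The argument needs only `100^k`; the constants give exponent `(8/3)(5/12) L = (10/9) L ≥
      -- L`.
      have h3 : (100 : ℝ) ^ k ≤ 144 ^ k := pow_le_pow_left₀ (by norm_num) (by norm_num) k
      calc L ≤ 10 / 9 * L := by linarith
        _ = 8 / 3 * (100 ^ k / ε ^ 2) * L * (5 / 12 * (ε ^ 2 / 100 ^ k)) := by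
          field_simp; norm_num
        _ ≤ 8 / 3 * (144 ^ k / ε ^ 2) * L * (5 / 12 * (ε ^ 2 / 100 ^ k)) := by gcongr
        _ ≤ N * (5 / 12 * (ε ^ 2 / 100 ^ k)) := by gcongr
  · intro ρ hρ S hS ω hω
    refine le_of_sq_le_sq ((traceNorm_sq_le _).trans ?_) hε.le
    rw [frobNorm_estimateReduced_sub_sq _ _ _ _ hρ.1.isHermitian, Fintype.card_coe,
      mul_inv_cancel_left₀ (by positivity)]
    have h1 : ∀ p : bothSides S → Fin 4,
        (estimate (pauli6Measurement (ChoiQubits n)) 0 ω (pauliString (extendPauli _ p)) -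
          (pauliString (extendPauli _ p) * ρ).trace.re) ^ 2 ≤
        ε ^ 2 / 100 ^ k * (c (extendPauli _ p))⁻¹ := fun p => by
      have h2 := pow_le_pow_left₀ (abs_nonneg _) (hω p) 2
      rw [sq_abs, div_pow, mul_pow, Real.sq_sqrt (hcpos _).le, ← pow_mul, mul_comm k 2,
        pow_mul] at h2
      refine h2.trans (le_of_eq ?_)
      norm_num
      ring
    refine (Finset.sum_le_sum fun p _ => h1 p).trans ?_
    rw [← Finset.mul_sum, sum_inv_prod_pauli6Weight, card_bothSides, hS, pow_mul]
    norm_num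

end Pauli6

/-! ### The Clifford group -/

section Clifford

open MeasurementPrimitive

variable {Q : Type} [Fintype Q] [DecidableEq Q]

theorem pauliSign1_symm (a b : Fin 4) : pauliSign1 a b = pauliSign1 b a := by
  have h : (a = 0 ∨ b = 0 ∨ a = b) ↔ (b = 0 ∨ a = 0 ∨ b = a) := by
    rw [eq_comm (a := a) (b := b)]; tauto
  simp only [pauliSign1, h]

omit [DecidableEq Q] in
theorem pauliSign_symm (s t : Q → Fin 4) : pauliSign s t = pauliSign t s :=
  Finset.prod_congr rfl fun _ _ => pauliSign1_symm _ _

theorem pauliSign1_xor (a b c : Fin 4) :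
    pauliSign1 a (b ^^^ c) = pauliSign1 a b * pauliSign1 a c := by
  have h : ∀ a b c : Fin 4, (a = 0 ∨ b ^^^ c = 0 ∨ a = b ^^^ c) ↔
      ((a = 0 ∨ b = 0 ∨ a = b) ↔ (a = 0 ∨ c = 0 ∨ a = c)) := by decide
  simp only [pauliSign1, h]
  by_cases h1 : a = 0 ∨ b = 0 ∨ a = b <;> by_cases h2 : a = 0 ∨ c = 0 ∨ a = c <;>
    simp [h1, h2]

omit [DecidableEq Q] in
theorem pauliSign_xor (s t u : Q → Fin 4) :
    pauliSign s (fun q => t q ^^^ u q) = pauliSign s t * pauliSign s u := by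
  simp only [pauliSign, pauliSign1_xor, Finset.prod_mul_distrib]

theorem exists_pauliSign_eq_neg_one {s : Q → Fin 4} (hs : s ≠ 0) : ∃ t, pauliSign s t = -1 := by
  obtain ⟨q, hq⟩ := Function.ne_iff.1 hs
  have h : ∀ a : Fin 4, a ≠ 0 → ∃ b : Fin 4, b ≠ 0 ∧ a ≠ b := by decide
  obtain ⟨b, hb0, hab⟩ := h (s q) hq
  refine ⟨Pi.single q b, ?_⟩
  rw [pauliSign, Finset.prod_eq_single q]
  · have hq' : s q ≠ 0 := hq
    simp [pauliSign1, hb0, hab, hq']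
  · intro r _ hr
    simp [pauliSign1, hr]
  · simp

/-- Take `u` anticommuting with `s` and `v` with `t`. If neither serves for both, their product
does, since the sign is multiplicative under xor. -/
theorem exists_pauliSign_eq_neg_one_both {s t : Q → Fin 4} (hs : s ≠ 0) (ht : t ≠ 0) :
    ∃ r, pauliSign s r = -1 ∧ pauliSign t r = -1 := by
  obtain ⟨u, hu⟩ := exists_pauliSign_eq_neg_one hs
  obtain ⟨v, hv⟩ := exists_pauliSign_eq_neg_one ht
  rcases pauliSign_eq t u with h1 | h1
  · rcases pauliSign_eq s v with h2 | h2
    · exact ⟨fun q => u q ^^^ v q, by rw [pauliSign_xor, hu, h2, mul_one],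
        by rw [pauliSign_xor, hv, h1, one_mul]⟩
    · exact ⟨v, h2, hv⟩
  · exact ⟨u, hu, h1⟩

omit [DecidableEq Q] in
theorem smul_one_injective {c : ℂ} (h : c • (1 : Op Q) = 1) : c = 1 := by
  have := congrFun (congrFun h 0) 0
  simpa using this

theorem mul_conj_mul (A B X : Op Q) :
    A * B * X * (A * B).conjTranspose = A * (B * X * B.conjTranspose) * A.conjTranspose := by
  rw [Matrix.conjTranspose_mul]
  simp only [mul_assoc]

/-- `A` maps, by conjugation, every Pauli string to a multiple of a Pauli string. -/
def NormalizesPaulis (A : Op Q) : Prop :=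
  ∀ u : Q → Fin 4, ∃ v : Q → Fin 4, ∃ c : ℂ,
    A * pauliString u * A.conjTranspose = c • pauliString v

/-- The image squares to the identity, so `c² = 1`. -/
theorem eq_or_neg_of_conj_pauliString {A : Op Q} (hA : A.conjTranspose * A = 1)
    (hA' : A * A.conjTranspose = 1) {u v : Q → Fin 4} {c : ℂ}
    (h : A * pauliString u * A.conjTranspose = c • pauliString v) :
    A * pauliString u * A.conjTranspose = pauliString v ∨
      A * pauliString u * A.conjTranspose = -pauliString v := by
  have h1 : (A * pauliString u * A.conjTranspose) * (A * pauliString u * A.conjTranspose) = 1 := by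
    calc _ = A * (pauliString u * (A.conjTranspose * A) * pauliString u) * A.conjTranspose := by
          simp only [mul_assoc]
      _ = 1 := by rw [hA, mul_one, pauliString_mul_self, mul_one, hA']
  rw [h, smul_mul_smul_comm, pauliString_mul_self] at h1
  rw [h]
  rcases mul_self_eq_one_iff.1 (smul_one_injective h1) with rfl | rfl
  · left; rw [one_smul]
  · right; rw [neg_one_smul]

/-- Every unitary that normalizes the Pauli strings is a Clifford unitary up to a phase. -/
theorem exists_clifford_of_normalizes {A : Op Q} (hA : A.conjTranspose * A = 1)
    (hA' : A * A.conjTranspose = 1) (hN : NormalizesPaulis A) :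
    ∃ U : Clifford Q, ∀ X : Op Q, U.1 * X * U.1.conjTranspose = A * X * A.conjTranspose := by
  have hAu : A ∈ Matrix.unitaryGroup (Bits Q) ℂ := Matrix.mem_unitaryGroup_iff.2 hA'
  have hdet : ‖A.det‖ = 1 := by
    have h := Matrix.det_of_mem_unitary hAu
    exact CStarRing.norm_of_mem_unitary h
  -- A phase that normalizes the determinant to one. It has modulus one, so conjugation is
  -- unaffected.
  obtain ⟨c, hc⟩ := IsAlgClosed.exists_pow_nat_eq (A.det)⁻¹
    (Fintype.card_pos (α := Bits Q))
  have hcn : ‖c‖ = 1 := by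
    have h := congrArg norm hc
    rw [norm_pow, norm_inv, hdet, inv_one] at h
    exact (pow_eq_one_iff_of_nonneg (norm_nonneg _) Fintype.card_ne_zero).1 h
  have hcc : c * star c = 1 := by
    rw [Complex.star_def, Complex.mul_conj', hcn]
    norm_num
  have hconj : ∀ X : Op Q, (c • A) * X * (c • A).conjTranspose = A * X * A.conjTranspose := by
    intro X
    rw [Matrix.conjTranspose_smul, smul_mul_assoc, smul_mul_smul_comm, hcc, one_smul]
  refine ⟨⟨c • A, ?_, ?_, fun u => ?_⟩, hconj⟩
  · rw [Matrix.mem_unitaryGroup_iff, Matrix.star_eq_conjTranspose]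
    have := hconj 1
    rwa [mul_one, mul_one, hA'] at this
  · rw [Matrix.det_smul, hc, inv_mul_cancel₀]
    intro h0
    rw [h0, norm_zero] at hdet
    exact zero_ne_one hdet
  · obtain ⟨v, d, h⟩ := hN u
    rw [hconj]
    exact ⟨v, eq_or_neg_of_conj_pauliString hA hA' h⟩

/-! ### Transitivity, finiteness and counting in the Clifford group. -/

namespace Clifford

theorem conjTranspose_mul_self (U : Clifford Q) : U.1.conjTranspose * U.1 = 1 :=
  Matrix.mem_unitaryGroup_iff'.1 U.2.1

theorem mul_conjTranspose_self (U : Clifford Q) : U.1 * U.1.conjTranspose = 1 :=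
  Matrix.mem_unitaryGroup_iff.1 U.2.1

/-- For anticommuting strings `P`, `R` the operator `A = (P + R)/√2` is a Hermitian involution that
exchanges them. It sends a string `X` to `±X` when `X` has the same commutation sign with both, and
to `±X P R` otherwise, so it is Clifford up to a phase. -/
theorem exists_conj_eq_of_anticommute {s t : Q → Fin 4} (h : pauliSign s t = -1) :
    ∃ U : Clifford Q, U.1 * pauliString s * U.1.conjTranspose = pauliString t := by
  set r : ℂ := (Real.sqrt 2 : ℂ)⁻¹ with hr
  have hrr : r * r = 1 / 2 := by
    rw [hr, ← mul_inv, ← Complex.ofReal_mul, Real.mul_self_sqrt (by norm_num)]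
    norm_num
  have hrs : star r = r := by
    rw [hr, Complex.star_def, map_inv₀, Complex.conj_ofReal]
  set P := pauliString s with hPdef
  set R := pauliString t with hRdef
  have hPP : P * P = 1 := pauliString_mul_self s
  have hRR : R * R = 1 := pauliString_mul_self t
  have hRP : R * P = -(P * R) := by
    have := pauliString_comm s t
    rw [h, neg_one_smul] at this
    rw [hPdef, hRdef, this, neg_neg]
  set A := r • (P + R) with hA
  have hAH : A.conjTranspose = A := by
    rw [hA, Matrix.conjTranspose_smul, hrs, Matrix.conjTranspose_add,
      (pauliString_isHermitian s).eq, (pauliString_isHermitian t).eq]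
  have hexp : ∀ X : Op Q, A * X * A =
      (1 / 2 : ℂ) • (P * X * P + P * X * R + R * X * P + R * X * R) := by
    intro X
    rw [hA, smul_mul_assoc, smul_mul_smul_comm, hrr]
    congr 1
    simp only [add_mul, mul_add]
    abel
  have hAA : A * A = 1 := by
    have := hexp 1
    simp only [mul_one, hPP, hRR, hRP] at this
    rw [this]
    have h2 : (1 : Op Q) + P * R + -(P * R) + 1 = (2 : ℂ) • 1 := by rw [two_smul]; abel
    rw [h2, smul_smul]
    norm_num
  have hN : NormalizesPaulis A := by
    intro u
    set X := pauliString u with hX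
    have hPX : P * X = pauliSign s u • (X * P) := pauliString_comm s u
    have hRX : R * X = pauliSign t u • (X * R) := pauliString_comm t u
    have h1 : P * X * P = pauliSign s u • X := by
      rw [hPX, smul_mul_assoc, mul_assoc, hPP, mul_one]
    have h2 : R * X * R = pauliSign t u • X := by
      rw [hRX, smul_mul_assoc, mul_assoc, hRR, mul_one]
    have h3 : P * X * R = pauliSign s u • (X * (P * R)) := by
      rw [hPX, smul_mul_assoc, mul_assoc]
    have h4 : R * X * P = -pauliSign t u • (X * (P * R)) := by
      rw [hRX, smul_mul_assoc, mul_assoc, hRP, mul_neg, smul_neg, neg_smul]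
    obtain ⟨c1, hc1⟩ := pauliString_mul s t
    obtain ⟨c2, hc2⟩ := pauliString_mul u fun q => s q ^^^ t q
    have h5 : X * (P * R) = (c1 * c2) • pauliString fun q => u q ^^^ (s q ^^^ t q) := by
      rw [hPdef, hRdef, hc1, hX, mul_smul_comm, hc2, smul_smul]
    rw [hAH, hexp, h1, h2, h3, h4, h5]
    rcases pauliSign_eq s u with ha | ha <;> rcases pauliSign_eq t u with hb | hb <;>
      rw [ha, hb]
    · exact ⟨u, 1, by module⟩
    · exact ⟨fun q => u q ^^^ (s q ^^^ t q), c1 * c2, by module⟩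
    · exact ⟨fun q => u q ^^^ (s q ^^^ t q), -(c1 * c2), by module⟩
    · exact ⟨u, -1, by module⟩
  obtain ⟨U, hU⟩ := exists_clifford_of_normalizes (by rw [hAH, hAA]) (by rw [hAH, hAA]) hN
  refine ⟨U, ?_⟩
  have h1 : P * P * P = P := by rw [hPP, one_mul]
  have h2 : P * P * R = R := by rw [hPP, one_mul]
  have h3 : R * P * P = R := by rw [mul_assoc, hPP, mul_one]
  have h4 : R * P * R = -P := by rw [hRP, neg_mul, mul_assoc, hRR, mul_one]
  rw [hU, hAH, hexp, h1, h2, h3, h4]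
  module

/-- The product of two Clifford unitaries. -/
def mul (V U : Clifford Q) : Clifford Q :=
  ⟨V.1 * U.1, mul_mem V.2.1 U.2.1, by rw [Matrix.det_mul, V.2.2.1, U.2.2.1, mul_one], fun s => by
    obtain ⟨t, ht⟩ := U.2.2.2 s
    obtain ⟨u, hu⟩ := V.2.2.2 t
    refine ⟨u, ?_⟩
    rw [mul_conj_mul]
    rcases ht with ht | ht <;> rcases hu with hu | hu <;> rw [ht] <;> simp [hu]⟩

theorem mul_conj (V U : Clifford Q) (X : Op Q) :
    (V.mul U).1 * X * (V.mul U).1.conjTranspose =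
      V.1 * (U.1 * X * U.1.conjTranspose) * V.1.conjTranspose :=
  mul_conj_mul V.1 U.1 X

theorem mul_right_injective (V : Clifford Q) : Function.Injective V.mul := by
  intro U W h
  have h1 : V.1 * U.1 = V.1 * W.1 := congrArg Subtype.val h
  have h2 : V.1.conjTranspose * (V.1 * U.1) = V.1.conjTranspose * (V.1 * W.1) := by rw [h1]
  rw [← mul_assoc, ← mul_assoc, V.conjTranspose_mul_self, one_mul, one_mul] at h2
  exact Subtype.ext h2

/-- Transitivity in two moves, through a string that anticommutes with both. -/
theorem exists_conj_eq {s t : Q → Fin 4} (hs : s ≠ 0) (ht : t ≠ 0) :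
    ∃ U : Clifford Q, U.1 * pauliString s * U.1.conjTranspose = pauliString t := by
  obtain ⟨r, hr, hr'⟩ := exists_pauliSign_eq_neg_one_both hs ht
  obtain ⟨U, hU⟩ := exists_conj_eq_of_anticommute hr
  obtain ⟨V, hV⟩ := exists_conj_eq_of_anticommute ((pauliSign_symm r t).trans hr')
  exact ⟨V.mul U, by rw [mul_conj, hU, hV]⟩

instance : Nonempty (Clifford Q) :=
  ⟨⟨1, one_mem _, Matrix.det_one, fun s => ⟨s, Or.inl (by simp)⟩⟩⟩

/-- The conjugation action has finitely many possible values on strings. Two elements with the same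
action differ by a scalar, and determinant one makes that scalar a root of unity of order dividing
the dimension. -/
instance : Finite (Clifford Q) := by
  set f : Clifford Q → (Q → Fin 4) → Op Q := fun U s =>
    U.1 * pauliString s * U.1.conjTranspose with hf
  set B : Set (Op Q) := Set.range pauliString ∪ Set.range fun s => -pauliString s with hB
  have hBf : B.Finite := (Set.finite_range _).union (Set.finite_range _)
  have hpi : {g : (Q → Fin 4) → Op Q | ∀ s, g s ∈ B}.Finite := Set.Finite.pi' fun _ => hBf
  have huniv : f ⁻¹' {g | ∀ s, g s ∈ B} = Set.univ := by
    refine Set.eq_univ_of_forall fun U s => ?_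
    obtain ⟨t, h | h⟩ := U.2.2.2 s
    · exact Or.inl ⟨t, h.symm⟩
    · exact Or.inr ⟨t, h.symm⟩
  refine Set.finite_univ_iff.1 (huniv ▸ hpi.preimage' fun g _ => ?_)
  rcases (f ⁻¹' {g}).eq_empty_or_nonempty with h | ⟨U, hU⟩
  · rw [h]; exact Set.finite_empty
  have hroots : {c : ℂ | c ^ Fintype.card (Bits Q) = 1}.Finite := by
    refine (Polynomial.nthRootsFinset (Fintype.card (Bits Q)) (1 : ℂ)).finite_toSet.subset ?_
    intro c hc
    exact (Polynomial.mem_nthRootsFinset Fintype.card_pos _).2 hc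
  refine Set.Finite.of_finite_image (f := Subtype.val) ((hroots.image fun c => c • U.1).subset ?_)
    Subtype.val_injective.injOn
  rintro _ ⟨V, hV, rfl⟩
  have hVU : ∀ s, V.1 * pauliString s * V.1.conjTranspose =
      U.1 * pauliString s * U.1.conjTranspose := fun s =>
    congrFun ((show f V = g from hV).trans (show f U = g from hU).symm) s
  obtain ⟨c, hc⟩ := eq_smul_one_of_commute_pauli (W := U.1.conjTranspose * V.1) fun s => by
    have h1 := congrArg (fun X => U.1.conjTranspose * X * V.1) (hVU s)
    calc U.1.conjTranspose * V.1 * pauliString s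
        = U.1.conjTranspose * (V.1 * pauliString s * V.1.conjTranspose) * V.1 := by
          rw [← mul_one (pauliString s), ← V.conjTranspose_mul_self]
          simp only [mul_assoc, V.conjTranspose_mul_self, mul_one]
      _ = U.1.conjTranspose * (U.1 * pauliString s * U.1.conjTranspose) * V.1 := h1
      _ = (U.1.conjTranspose * U.1) * pauliString s * (U.1.conjTranspose * V.1) := by
          simp only [mul_assoc]
      _ = pauliString s * (U.1.conjTranspose * V.1) := by rw [U.conjTranspose_mul_self, one_mul]
  have hVc : V.1 = c • U.1 := by
    have h1 := congrArg (U.1 * ·) hc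
    simp only [← mul_assoc, U.mul_conjTranspose_self, one_mul, mul_smul_comm, mul_one] at h1
    exact h1
  refine ⟨c, ?_, hVc.symm⟩
  have h2 := V.2.2.1
  rw [hVc, Matrix.det_smul, U.2.2.1, mul_one] at h2
  exact h2

instance : Fintype (Clifford Q) := Fintype.ofFinite _

/-- The Pauli string to which `s` is mapped, up to sign, by conjugation. -/
def label (U : Clifford Q) (s : Q → Fin 4) : Q → Fin 4 := (U.2.2.2 s).choose

theorem conj_label (U : Clifford Q) (s : Q → Fin 4) : ∃ c : ℂ, c * c = 1 ∧
    U.1 * pauliString s * U.1.conjTranspose = c • pauliString (U.label s) := by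
  rcases (U.2.2.2 s).choose_spec with h | h
  · exact ⟨1, by norm_num, by rw [one_smul]; exact h⟩
  · exact ⟨-1, by norm_num, by rw [neg_one_smul]; exact h⟩

theorem label_eq {U : Clifford Q} {s t : Q → Fin 4} {c : ℂ}
    (h : U.1 * pauliString s * U.1.conjTranspose = c • pauliString t) : U.label s = t := by
  obtain ⟨d, hd, h'⟩ := U.conj_label s
  refine pauliString_label_unique (c := d * c) ?_
  rw [mul_smul, ← h, h', smul_smul, hd, one_smul]

theorem label_mul {V U : Clifford Q} {s t : Q → Fin 4}
    (h : V.1 * pauliString (U.label s) * V.1.conjTranspose = pauliString t) :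
    (V.mul U).label s = t := by
  obtain ⟨c, -, h'⟩ := U.conj_label s
  refine label_eq (c := c) ?_
  rw [mul_conj, h', mul_smul_comm, smul_mul_assoc, h]

theorem label_ne_zero (U : Clifford Q) {s : Q → Fin 4} (hs : s ≠ 0) : U.label s ≠ 0 := by
  intro h0
  obtain ⟨c, -, h⟩ := U.conj_label s
  rw [h0, pauliString_zero] at h
  refine hs (pauliString_label_unique (c := c) ?_)
  have h1 := congrArg (fun X => U.1.conjTranspose * X * U.1) h
  simp only [mul_smul_comm, mul_one, smul_mul_assoc, U.conjTranspose_mul_self] at h1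
  rw [pauliString_zero, ← h1]
  calc pauliString s = (U.1.conjTranspose * U.1) * pauliString s * (U.1.conjTranspose * U.1) := by
        rw [U.conjTranspose_mul_self, one_mul, mul_one]
    _ = _ := by simp only [mul_assoc]

theorem label_zero (U : Clifford Q) : U.label 0 = 0 :=
  label_eq (c := 1) (by
    rw [pauliString_zero, mul_one, U.mul_conjTranspose_self, one_smul])

/-- The labels of the Pauli strings that are diagonal in the computational basis. -/
def diagLabels (Q : Type) [Fintype Q] [DecidableEq Q] : Finset (Q → Fin 4) :=
  Fintype.piFinset fun _ => {0, 3}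

/-- The number of Clifford unitaries that map `s` to `t` up to sign. -/
def fiberCard (s t : Q → Fin 4) : ℕ :=
  (Finset.univ.filter fun U : Clifford Q => U.label s = t).card

/-- Left multiplication by a Clifford unitary taking `t` to `t'` injects one fibre into the other.
-/
theorem fiberCard_le {s t t' : Q → Fin 4} (ht : t ≠ 0) (ht' : t' ≠ 0) :
    fiberCard s t ≤ fiberCard s t' := by
  obtain ⟨V, hV⟩ := exists_conj_eq ht ht'
  refine Finset.card_le_card_of_injOn V.mul (fun U hU => ?_) V.mul_right_injective.injOn
  have hU' : U.label s = t := by simpa using hU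
  have : (V.mul U).label s = t' := label_mul (by rw [hU', hV])
  simpa using this

/-- The number of Clifford unitaries that diagonalize `s`. -/
def diagCard (s : Q → Fin 4) : ℕ :=
  (Finset.univ.filter fun U : Clifford Q => U.label s ∈ diagLabels Q).card

/-- A fraction `1 / (2 ^ |Q| + 1)` of the Clifford group diagonalizes a given Pauli string. -/
theorem card_eq_mul_diagCard {s : Q → Fin 4} (hs : s ≠ 0) :
    Fintype.card (Clifford Q) = (2 ^ Fintype.card Q + 1) * diagCard s := by
  have hfib : ∀ t, t ≠ 0 → fiberCard s t = fiberCard s s := fun t ht =>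
    le_antisymm (fiberCard_le ht hs) (fiberCard_le hs ht)
  have h0 : (0 : Q → Fin 4) ∈ diagLabels Q := by simp [diagLabels]
  -- With `m = |Q|`, all `4^m - 1` nonidentity images are equally frequent and `2^m - 1` of them are
  -- diagonal; the ratio is `2^m + 1`.
  have h1 : Fintype.card (Clifford Q) = (4 ^ Fintype.card Q - 1) * fiberCard s s := by
    rw [← Finset.card_univ, Finset.card_eq_sum_card_fiberwise (f := fun U => U.label s)
      (t := Finset.univ.erase 0) fun U _ => by simpa using U.label_ne_zero hs]
    refine (Finset.sum_congr rfl fun t ht => hfib t (Finset.ne_of_mem_erase ht)).trans ?_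
    rw [Finset.sum_const, Finset.card_erase_of_mem (Finset.mem_univ _), smul_eq_mul]
    simp
  have h2 : diagCard s = (2 ^ Fintype.card Q - 1) * fiberCard s s := by
    rw [diagCard, Finset.card_eq_sum_card_fiberwise (f := fun U => U.label s)
      (t := (diagLabels Q).erase 0) fun U hU => by
        simpa [U.label_ne_zero hs] using hU]
    have h3 : ∀ t ∈ (diagLabels Q).erase 0,
        ((Finset.univ.filter fun U : Clifford Q => U.label s ∈ diagLabels Q).filter
          fun U => U.label s = t).card = fiberCard s s := by
      intro t ht
      rw [← hfib t (Finset.ne_of_mem_erase ht), fiberCard, Finset.filter_filter]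
      congr 1
      refine Finset.filter_congr fun U _ => ?_
      constructor
      · exact fun h => h.2
      · rintro rfl
        exact ⟨Finset.mem_of_mem_erase ht, rfl⟩
    rw [Finset.sum_congr rfl h3, Finset.sum_const, Finset.card_erase_of_mem h0, smul_eq_mul]
    congr 2
    simp [diagLabels]
  rw [h1, h2, ← mul_assoc]
  congr 1
  have h4 : 4 ^ Fintype.card Q = 2 ^ Fintype.card Q * 2 ^ Fintype.card Q := by
    rw [← mul_pow]; norm_num
  rw [h4]
  have := Nat.mul_self_sub_mul_self_eq (2 ^ Fintype.card Q) 1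
  simpa using this

theorem diagCard_pos (s : Q → Fin 4) : 0 < diagCard s := by
  have hpos : 0 < Fintype.card (Clifford Q) := Fintype.card_pos
  by_cases hs : s = 0
  · have : (Finset.univ.filter fun U : Clifford Q => U.label s ∈ diagLabels Q) = Finset.univ := by
      refine Finset.filter_true_of_mem fun U _ => ?_
      rw [hs, label_zero]
      simp [diagLabels]
    rwa [diagCard, this, Finset.card_univ]
  · rw [card_eq_mul_diagCard hs] at hpos
    exact Nat.pos_of_mul_pos_left hpos

end Clifford

end Clifford

/-! ### Random global Clifford measurements -/

section CliffordMeasurement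

open MeasurementPrimitive

variable {Q : Type} [Fintype Q] [DecidableEq Q]

theorem cliffordMeasurement_ketbra (ω : Clifford Q × Bits Q) (x y : Bits Q) :
    ketbra ((cliffordMeasurement Q).state ω) x y = star (ω.1.1 ω.2 x) * ω.1.1 ω.2 y := by
  simp [ketbra, Matrix.vecMulVec_apply, cliffordMeasurement, unitaryEnsemble]

theorem cliffordMeasurement_ev (A : Op Q) (ω : Clifford Q × Bits Q) :
    (cliffordMeasurement Q).ev A ω = (ω.1.1 * A * ω.1.1.conjTranspose) ω.2 ω.2 := by
  rw [ev_eq_sum]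
  simp only [cliffordMeasurement_ketbra, Matrix.mul_apply, Matrix.conjTranspose_apply,
    Finset.sum_mul]
  rw [Finset.sum_comm]
  exact Finset.sum_congr rfl fun x _ => Finset.sum_congr rfl fun y _ => by ring

theorem cliffordMeasurement_isFiniteMeasure : IsFiniteMeasure (cliffordMeasurement Q).weight := by
  have h : IsFiniteMeasure
      ((Nat.card (Clifford Q) : ENNReal)⁻¹ • (Measure.count : Measure (Clifford Q))) :=
    Measure.smul_finite _ (by simp [Nat.card_eq_fintype_card, Fintype.card_ne_zero])
  unfold cliffordMeasurement unitaryEnsemble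
  infer_instance

theorem cliffordMeasurement_integral (f : Clifford Q × Bits Q → ℂ) :
    ∫ ω, f ω ∂(cliffordMeasurement Q).weight =
      (Fintype.card (Clifford Q) : ℂ)⁻¹ * ∑ U, ∑ b, f (U, b) := by
  have := cliffordMeasurement_isFiniteMeasure (Q := Q)
  have hs : MeasurableSingletonClass (Clifford Q) := ⟨fun _ => trivial⟩
  have hfin : IsFiniteMeasure
      ((Nat.card (Clifford Q) : ENNReal)⁻¹ • (Measure.count : Measure (Clifford Q))) :=
    Measure.smul_finite _ (by simp [Nat.card_eq_fintype_card, Fintype.card_ne_zero])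
  have h1 : ∀ ω, (cliffordMeasurement Q).weight.real {ω} =
      (Fintype.card (Clifford Q) : ℝ)⁻¹ := by
    rintro ⟨U, b⟩
    rw [cliffordMeasurement, unitaryEnsemble, ← Set.singleton_prod_singleton, Measure.real,
      Measure.prod_prod]
    simp
  rw [integral_fintype (Integrable.of_finite)]
  simp only [h1, Fintype.sum_prod_type, Finset.mul_sum, Complex.real_smul]
  push_cast
  rfl

theorem pauli1_diag_eq_zero {a : Fin 4} (ha : a ∉ ({0, 3} : Finset (Fin 4))) (i : Fin 2) :
    pauli1 a i i = 0 := by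
  fin_cases a <;> fin_cases i <;> simp [pauli1] at ha ⊢

theorem pauli1_off_diag_eq_zero {a : Fin 4} (ha : a ∈ ({0, 3} : Finset (Fin 4))) {i j : Fin 2}
    (hij : i ≠ j) : pauli1 a i j = 0 := by
  fin_cases a <;> fin_cases i <;> fin_cases j <;> simp [pauli1] at ha hij ⊢

theorem pauliString_diag_eq_zero {t : Q → Fin 4} (ht : t ∉ Clifford.diagLabels Q) (b : Bits Q) :
    pauliString t b b = 0 := by
  simp only [Clifford.diagLabels, Fintype.mem_piFinset, not_forall] at ht
  obtain ⟨q, hq⟩ := ht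
  exact Finset.prod_eq_zero (Finset.mem_univ q) (pauli1_diag_eq_zero hq _)

theorem pauliString_off_diag_eq_zero {t : Q → Fin 4} (ht : t ∈ Clifford.diagLabels Q)
    {b b' : Bits Q} (hb : b ≠ b') : pauliString t b b' = 0 := by
  obtain ⟨q, hq⟩ := Function.ne_iff.1 hb
  exact Finset.prod_eq_zero (Finset.mem_univ q)
    (pauli1_off_diag_eq_zero (Fintype.mem_piFinset.1 ht q) hq)

/-- Measuring keeps only the diagonal of the conjugated string. A diagonal string survives intact
and is rotated back to `s`; any other has zero diagonal. Averaging over the group therefore gives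
the fraction that diagonalizes `s`. -/
theorem sum_conj_diag_mul (U : Clifford Q) (s : Q → Fin 4) (x y : Bits Q) :
    ∑ b, (U.1 * pauliString s * U.1.conjTranspose) b b * (star (U.1 b x) * U.1 b y) =
      if U.label s ∈ Clifford.diagLabels Q then pauliString s x y else 0 := by
  obtain ⟨c, -, h⟩ := U.conj_label s
  split_ifs with hd
  · have h1 : pauliString s =
        U.1.conjTranspose * (U.1 * pauliString s * U.1.conjTranspose) * U.1 := by
      calc pauliString s
          = (U.1.conjTranspose * U.1) * pauliString s * (U.1.conjTranspose * U.1) := by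
            rw [U.conjTranspose_mul_self, one_mul, mul_one]
        _ = _ := by simp only [mul_assoc]
    conv_rhs => rw [h1]
    rw [h, Matrix.mul_apply]
    refine Finset.sum_congr rfl fun b _ => ?_
    rw [Matrix.mul_apply, Finset.sum_eq_single b]
    · rw [Matrix.conjTranspose_apply]
      ring
    · intro b' _ hb
      rw [Matrix.smul_apply, pauliString_off_diag_eq_zero hd hb, smul_zero, mul_zero]
    · simp
  · refine Finset.sum_eq_zero fun b _ => ?_
    rw [h, Matrix.smul_apply, pauliString_diag_eq_zero hd, smul_zero, zero_mul]

theorem sum_conj_diag_sq_mul (U : Clifford Q) (s : Q → Fin 4) (x y : Bits Q) :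
    ∑ b, (U.1 * pauliString s * U.1.conjTranspose) b b ^ 2 * (star (U.1 b x) * U.1 b y) =
      if U.label s ∈ Clifford.diagLabels Q then (1 : Op Q) x y else 0 := by
  obtain ⟨c, hc, h⟩ := U.conj_label s
  split_ifs with hd
  · rw [← U.conjTranspose_mul_self, Matrix.mul_apply]
    refine Finset.sum_congr rfl fun b _ => ?_
    have h1 : pauliString (U.label s) b b * pauliString (U.label s) b b = 1 := by
      have h2 := congrFun (congrFun (pauliString_mul_self (U.label s)) b) b
      rw [Matrix.mul_apply, Finset.sum_eq_single b] at h2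
      · simpa using h2
      · intro b' _ hb
        rw [pauliString_off_diag_eq_zero hd hb, mul_zero]
      · simp
    rw [h, Matrix.smul_apply, smul_eq_mul, mul_pow, pow_two, pow_two, hc, h1, one_mul, one_mul,
      Matrix.conjTranspose_apply]
  · refine Finset.sum_eq_zero fun b _ => ?_
    rw [h, Matrix.smul_apply, pauliString_diag_eq_zero hd, smul_zero]
    simp

theorem cliffordMeasurement_isPOVM : (cliffordMeasurement Q).IsPOVM := by
  have hs : MeasurableSingletonClass (Clifford Q) := ⟨fun _ => trivial⟩
  refine ⟨cliffordMeasurement_isFiniteMeasure, measurable_of_finite _, ?_, ?_⟩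
  · rintro ⟨U, b⟩
    have h := congrFun (congrFun U.mul_conjTranspose_self b) b
    rw [Matrix.mul_apply, Matrix.one_apply_eq] at h
    have h2 : ((∑ x, ‖(cliffordMeasurement Q).state (U, b) x‖ ^ 2 : ℝ) : ℂ) = 1 := by
      rw [← h]
      push_cast
      refine Finset.sum_congr rfl fun x _ => ?_
      rw [Matrix.conjTranspose_apply, Complex.star_def, Complex.mul_conj']
      simp [cliffordMeasurement, unitaryEnsemble]
    exact_mod_cast h2
  · intro x y
    rw [cliffordMeasurement_integral]
    simp only [cliffordMeasurement_ketbra]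
    have h : ∀ U : Clifford Q, ∑ b, star (U.1 b x) * U.1 b y = (1 : Op Q) x y := fun U => by
      rw [← U.conjTranspose_mul_self, Matrix.mul_apply]
      rfl
    simp only [h, Finset.sum_const, Finset.card_univ, nsmul_eq_mul]
    rw [inv_mul_cancel_left₀]
    exact_mod_cast Fintype.card_ne_zero

theorem cliffordMeasurement_isPauliDiagonal :
    IsPauliDiagonal (cliffordMeasurement Q) fun s =>
      (Clifford.diagCard s : ℝ) / Fintype.card (Clifford Q) where
  pos s := by
    have h1 : (0 : ℝ) < Clifford.diagCard s := by exact_mod_cast Clifford.diagCard_pos s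
    have h2 : (0 : ℝ) < Fintype.card (Clifford Q) := by exact_mod_cast Fintype.card_pos
    positivity
  first s x y := by
    rw [cliffordMeasurement_integral]
    simp only [cliffordMeasurement_ketbra, cliffordMeasurement_ev, sum_conj_diag_mul]
    rw [← Finset.sum_filter, Finset.sum_const, nsmul_eq_mul]
    simp only [Clifford.diagCard]
    push_cast
    ring
  second s x y := by
    rw [cliffordMeasurement_integral]
    simp only [cliffordMeasurement_ketbra, cliffordMeasurement_ev, sum_conj_diag_sq_mul]
    rw [← Finset.sum_filter, Finset.sum_const, nsmul_eq_mul]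
    simp only [Clifford.diagCard]
    push_cast
    ring

/-- The inverse eigenvalue at a nonidentity string is `2^|Q| + 1`; the looser `3 · 2^|Q|` produces
the constant `204 = 3 · 68`. -/
theorem cliffordMeasurement_shadowNorm_sq_le (s : Q → Fin 4) :
    (cliffordMeasurement Q).shadowNorm (traceless (pauliString s)) ^ 2 ≤
      3 * 2 ^ Fintype.card Q := by
  have hP := cliffordMeasurement_isPOVM (Q := Q)
  have hc := cliffordMeasurement_isPauliDiagonal (Q := Q)
  by_cases hs : s = 0
  · rw [hs, pauliString_zero, traceless_one]
    exact (shadowNorm_zero_sq hP (hc.tomographicallyComplete hP)).trans (by positivity)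
  · refine hc.shadowNorm_traceless_sq_le hP (by positivity) ?_
    have h1 : (0 : ℝ) < Clifford.diagCard s := by exact_mod_cast Clifford.diagCard_pos s
    have h2 : (1 : ℝ) ≤ 2 ^ Fintype.card Q := one_le_pow₀ (by norm_num)
    rw [Clifford.card_eq_mul_diagCard hs]
    push_cast
    rw [inv_div, mul_div_cancel_right₀ _ h1.ne']
    linarith

theorem cliffordMeasurement_suffices_frobNorm {n k : ℕ} {ε δ : ℝ} {N : ℕ} (hk : 1 ≤ k)
    (hn : 1 ≤ n) (hε : 0 < ε) (hε1 : ε < 1) (hδ : 0 < δ) (hδ1 : δ < 1)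
    (hN : 204 / ε ^ 2 * 4 ^ (n + k) * Real.log (2 * (8 * n) ^ (2 * k) / δ) ≤ N) :
    Suffices (cliffordMeasurement (ChoiQubits n)) frobNorm k ε δ N := by
  have hP := cliffordMeasurement_isPOVM (Q := ChoiQubits n)
  have hc := cliffordMeasurement_isPauliDiagonal (Q := ChoiQubits n)
  have hcard : (2 : ℝ) ^ Fintype.card (ChoiQubits n) = 4 ^ n := by
    rw [Fintype.card_sum, Fintype.card_fin, ← two_mul, pow_mul]
    norm_num
  refine suffices_frobNorm hP (hc.tomographicallyComplete hP) hk hn hε hε1 hδ hδ1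
    (V := 3 * 4 ^ n) ?_ (fun S _ p => ?_) (le_trans (le_of_eq ?_) hN)
  · have : (1 : ℝ) ≤ 4 ^ n := one_le_pow₀ (by norm_num)
    linarith
  · rw [← hcard]
    exact cliffordMeasurement_shadowNorm_sq_le _
  · rw [pow_add]; ring

end CliffordMeasurement

end ShadowQPT

end

theorem theorem1 (n k : ℕ) (hk : 1 ≤ k) (hkn : k ≤ n) (ε δ : ℝ) (hε : 0 < ε) (hε1 : ε < 1)
    (hδ : 0 < δ) (hδ1 : δ < 1) :
    (∀ (Ω : Type*) [MeasurableSpace Ω] (P : MeasurementPrimitive (ChoiQubits n) Ω),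
      P.IsPOVM → P.TomographicallyComplete →
      ∀ N : ℕ, 68 / ε ^ 2 * 4 ^ k * Real.log (2 * (8 * n) ^ (2 * k) / δ) * maxShadowNormSq k P ≤ N →
        Suffices P frobNorm k ε δ N) ∧
    (∀ N : ℕ, 204 / ε ^ 2 * 4 ^ (n + k) * Real.log (2 * (8 * n) ^ (2 * k) / δ) ≤ N →
        Suffices (cliffordMeasurement (ChoiQubits n)) frobNorm k ε δ N) ∧
    (∀ N : ℕ, 68 / ε ^ 2 * 36 ^ k * Real.log (2 * (8 * n) ^ (2 * k) / δ) ≤ N →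
        Suffices (pauli6Measurement (ChoiQubits n)) frobNorm k ε δ N) ∧
    (∀ N : ℕ, 8 / 3 * (144 ^ k / ε ^ 2) * Real.log ((24 * n) ^ (2 * k) / δ) ≤ N →
        Suffices (pauli6Measurement (ChoiQubits n)) traceNorm k ε δ N) := by
  have hn := hk.trans hkn
  refine ⟨fun Ω _ P hP hT N hN => ?_, fun N hN => ?_, fun N hN => ?_, fun N hN => ?_⟩
  · exact suffices_frobNorm hP hT hk hn hε hε1 hδ hδ1 (one_le_maxShadowNormSq hP hT hk hkn)
      (fun S hS p => shadowNorm_sq_le_maxShadowNormSq hS p) hN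
  · exact cliffordMeasurement_suffices_frobNorm hk hn hε hε1 hδ hδ1 hN
  · exact pauli6_suffices_frobNorm hk hn hε hε1 hδ hδ1 hN
  · exact pauli6_suffices_traceNorm hk hn hε hε1 hδ hδ1 hN
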